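/- **Setting.** Let $n\ge 1$, let $\Omega\subseteq\mathbb R^n$ be open and bounded with Lipschitz boundary, let $1<p<\frac{n}{n-1}$ (with $\frac{n}{n-1}:=\infty$ if $n=1$), let $p'=\frac{p}{p-1}$, and let $\alpha>0$. For $v\in L^p(\Omega)$ put $\mathcal G_1(v)=\int_\Omega|v|\,dx$, and let $\mathcal E_{TV}(v)$ be the total variation $\int_{\mathbb R^n}d|Dv|$ on $\mathbb R^n$ of the extension of $v$ by zero if $v\in BV(\Omega)$, and $\mathcal E_{TV}(v)=\infty$ if $v\in L^p(\Omega)\setminus BV(\Omega)$. Let $C_{BV}$ be the embedding constant of $W^{1,1}_0(\Omega)$ in $L^{n/(n-1)}(\Omega)$, i.e. the smallest constant with $\|v\|_{n/(n-1)}\le C_{BV}\|Dv\|_1$ for all $v\in W^{1,1}_0(\Omega)$. Let $I_{\{\mathcal G_1=\alpha\}}$ be $0$ where $\mathcal G_1=\alpha$ and $\infty$ elsewhere. **Weak slope.** For a metric space $(M,d)$ and a continuous $f:M\to\mathbb R$, the weak slope $|df|(u)\in[0,\infty]$ is the supremum of all $\sigma\in[0,\infty)$ for which there are $\delta>0$ and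 a continuous $\eta:B_\delta(u)\times[0,\delta]\to M$ with $d(\eta(v,t),v)\le t$ and $f(\eta(v,t))\le f(v)-\sigma t$ for all $(v,t)$. For a lower semicontinuous $F:M\to\mathbb R\cup\{\infty\}$ let $\mathcal H(v,t)=t$ on the epigraph $\{(v,t)\in M\times\mathbb R: F(v)\le t\}$ with the metric $\sqrt{d(v_1,v_2)^2+(t_1-t_2)^2}$. Where $F(u)<\infty$, put $s=|d\mathcal H|(u,F(u))\le 1$ and $|dF|(u)=s/\sqrt{1-s^2}$ if $s<1$, $|dF|(u)=\infty$ if $s=1$. $F$ satisfies the Palais–Smale condition if, for every $c\in\mathbb R$, every sequence $(u_j)$ in $M$ with $F(u_j)\to c$ and $|dF|(u_j)\to0$ has a convergent subsequence. **Proposition.** Let $\mathcal E_{Per}:L^p(\Omega)\to\mathbb R$ and $C_{Per}>0$ be such that - (E1) $\mathcal E_{Per}$ is locally Lipschitz continuous; - (E2) $\mathcal E_{Per}(-v)=\mathcal E_{Per}(v)$ for all $v\in L^p(\Omega)$; - (E3) $|\mathcal E_{Per}(v)|\le C_{Per}\|v\|_p^p$ for all $v\in L^p(\Omega)$; - (E4)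 $\|v^*\|_{p'}\le p\,C_{Per}\|v\|_p^{p-1}$ for all $v\in L^p(\Omega)$ and all $v^*\in\partial\mathcal E_{Per}(v)\subseteq L^{p}(\Omega)^*=L^{p'}(\Omega)$, where $\partial$ is Clarke's generalized gradient. Assume moreover that one of the following holds: - (E5') $\mathcal E_{Per}$ is bounded from below on $L^p(\Omega)$; - (E5'') $p\le 1+\frac1n$ and $\alpha^{\,n-(n-1)p}<C_{Per}^{-1}\,C_{BV}^{-(p-1)n}$. Then $\mathcal E=\mathcal E_{TV}+\mathcal E_{Per}+I_{\{\mathcal G_1=\alpha\}}:L^p(\Omega)\to\mathbb R\cup\{\infty\}$ satisfies the Palais–Smale condition on $L^p(\Omega)$. -/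

import Mathlib

open Set Filter Topology MeasureTheory
open scoped ENNReal NNReal ContDiff

noncomputable section

/-! ### Weak slope and the Palais-Smale condition -/

section Slope

variable {M : Type*} [MetricSpace M]

/-- The weak slope of a (continuous) function `f : M → ℝ` at `u`: the supremum of all
`σ ∈ [0, ∞)` for which there are `δ > 0` and a continuous
`η : B_δ(u) × [0, δ] → M` with `d(η(v,t), v) ≤ t` and `f(η(v,t)) ≤ f(v) - σ t`. -/
def weakSlope (f : M → ℝ) (u : M) : ℝ≥0∞ :=
  ⨆ (σ : ℝ≥0) (_ : ∃ δ : ℝ, 0 < δ ∧ ∃ η : M × ℝ → M,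
      ContinuousOn η (Metric.ball u δ ×ˢ Icc (0 : ℝ) δ) ∧
      ∀ v ∈ Metric.ball u δ, ∀ t ∈ Icc (0 : ℝ) δ,
        dist (η (v, t)) v ≤ t ∧ f (η (v, t)) ≤ f v - (σ : ℝ) * t), (σ : ℝ≥0∞)

/-- The epigraph of `F : M → (-∞, ∞]`. Its metric is the one induced by
`WithLp 2 (M × ℝ)`, that is `√(d(v₁,v₂)² + (t₁ - t₂)²)`. -/
def Epigraph (F : M → EReal) : Type _ :=
  {z : WithLp 2 (M × ℝ) // F z.fst ≤ (z.snd : EReal)}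

instance (F : M → EReal) : MetricSpace (Epigraph F) :=
  inferInstanceAs (MetricSpace {z : WithLp 2 (M × ℝ) // F z.fst ≤ (z.snd : EReal)})

/-- The projection `(v, t) ↦ t` of the epigraph to `ℝ`. -/
def epiHeight (F : M → EReal) (z : Epigraph F) : ℝ := z.1.snd

/-- The point `(u, F u)` of the epigraph, for `u` with `F u < ∞`. -/
def epiPoint (F : M → EReal) (u : M) (hu : F u ≠ ⊤) : Epigraph F :=
  ⟨WithLp.toLp 2 (u, (F u).toReal), EReal.le_coe_toReal hu⟩

open Classical in
/-- The weak slope `|dF|(u)` of a lower semicontinuous function `F : M → (-∞, ∞]`, defined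
through the weak slope `s` of the height function on the epigraph at `(u, F u)`:
it is `s / √(1 - s²)` if `s < 1` and `∞` otherwise (always `s ≤ 1`, because the height function
is 1-Lipschitz). At points with `F u = ∞`, where the notion is not used, the value is `∞`. -/
def lscWeakSlope (F : M → EReal) (u : M) : ℝ≥0∞ :=
  if hu : F u ≠ ⊤ then
    if weakSlope (epiHeight F) (epiPoint F u hu) < 1 then
      ENNReal.ofReal ((weakSlope (epiHeight F) (epiPoint F u hu)).toReal /
        √(1 - (weakSlope (epiHeight F) (epiPoint F u hu)).toReal ^ 2))
    else ⊤
  else ⊤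

/-- The (PS)-condition at level `c`: every Palais-Smale sequence, i.e. every `(u_j)` with
`F(u_j) → c` and `|dF|(u_j) → 0`, has a convergent subsequence. -/
def PalaisSmaleAt (F : M → EReal) (c : ℝ) : Prop :=
  ∀ u : ℕ → M,
    Tendsto (fun j => F (u j)) atTop (𝓝 (c : EReal)) →
    Tendsto (fun j => lscWeakSlope F (u j)) atTop (𝓝 0) →
    ∃ k : ℕ → ℕ, StrictMono k ∧ ∃ x : M, Tendsto (fun j => u (k j)) atTop (𝓝 x)

/-- The (PS)-condition: the (PS)-condition at every level `c ∈ ℝ`. -/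
def PalaisSmale (F : M → EReal) : Prop := ∀ c : ℝ, PalaisSmaleAt F c

end Slope

/-! ### Clarke's generalized gradient -/

section Clarke

variable {X : Type*} [NormedAddCommGroup X] [NormedSpace ℝ X]

/-- Clarke's generalized directional derivative
`F⁰(u; h) = limsup_{w → u, t ↓ 0} (F (w + t h) - F w) / t`. -/
def clarkeDeriv (F : X → ℝ) (u h : X) : EReal :=
  limsup (fun q : X × ℝ => (((F (q.1 + q.2 • h) - F q.1) / q.2 : ℝ) : EReal))
    (𝓝 u ×ˢ 𝓝[>] (0 : ℝ))

/-- Clarke's generalized gradient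
`∂F(u) = {u* ∈ X* | ⟨u*, h⟩ ≤ F⁰(u; h) for all h ∈ X}`. -/
def clarkeGradient (F : X → ℝ) (u : X) : Set (StrongDual ℝ X) :=
  {ξ | ∀ h : X, ((ξ h : ℝ) : EReal) ≤ clarkeDeriv F u h}

end Clarke

/-! ### Domains, Sobolev functions, functions of bounded variation -/

section Domain

variable {n : ℕ}

/-- `Ω` has Lipschitz boundary: near each boundary point, `Ω` is the set of points lying strictly
above the graph of a Lipschitz function, with respect to some direction `e`. (The function `γ` is
evaluated at the orthogonal projection of `y` on the hyperplane orthogonal to `e`.) -/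
def HasLipschitzBoundary (Ω : Set (EuclideanSpace ℝ (Fin n))) : Prop :=
  ∀ x ∈ frontier Ω, ∃ r : ℝ, 0 < r ∧ ∃ e : EuclideanSpace ℝ (Fin n), ‖e‖ = 1 ∧
    ∃ (K : ℝ≥0) (γ : EuclideanSpace ℝ (Fin n) → ℝ), LipschitzWith K γ ∧
      ∀ y ∈ Metric.ball x r, y ∈ Ω ↔ γ (y - inner ℝ e y • e) < inner ℝ e y

/-- Real-valued smooth functions with compact support in `Ω`. -/
def IsTestFunction (Ω : Set (EuclideanSpace ℝ (Fin n)))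
    (φ : EuclideanSpace ℝ (Fin n) → ℝ) : Prop :=
  ContDiff ℝ ∞ φ ∧ HasCompactSupport φ ∧ tsupport φ ⊆ Ω

/-- `g` is a weak gradient of `v` on `Ω`. -/
def HasWeakGradient (Ω : Set (EuclideanSpace ℝ (Fin n))) (v : EuclideanSpace ℝ (Fin n) → ℝ)
    (g : EuclideanSpace ℝ (Fin n) → EuclideanSpace ℝ (Fin n)) : Prop :=
  ∀ φ, IsTestFunction Ω φ → ∫ x in Ω, v x • gradient φ x = - ∫ x in Ω, φ x • g x

/-- `v ∈ W^{1,1}_0(Ω)` with `Dv = g`: `v` and its weak gradient `g` are integrable on `Ω`, and `v`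
is a limit in `W^{1,1}(Ω)` of test functions. -/
structure MemW110 (Ω : Set (EuclideanSpace ℝ (Fin n))) (v : EuclideanSpace ℝ (Fin n) → ℝ)
    (g : EuclideanSpace ℝ (Fin n) → EuclideanSpace ℝ (Fin n)) : Prop where
  memLp : MemLp v 1 (volume.restrict Ω)
  memLp_gradient : MemLp g 1 (volume.restrict Ω)
  hasWeakGradient : HasWeakGradient Ω v g
  exists_approx : ∃ φ : ℕ → EuclideanSpace ℝ (Fin n) → ℝ, (∀ k, IsTestFunction Ω (φ k)) ∧
    Tendsto (fun k => eLpNorm (fun x => φ k x - v x) 1 (volume.restrict Ω)) atTop (𝓝 0) ∧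
    Tendsto (fun k => eLpNorm (fun x => gradient (φ k) x - g x) 1 (volume.restrict Ω))
      atTop (𝓝 0)

/-- The critical exponent `n / (n - 1)`, which is `∞` for `n = 1`. -/
def critExponent (n : ℕ) : ℝ≥0∞ := (n : ℝ≥0∞) / ((n : ℝ≥0∞) - 1)

/-- The embedding constant `C_BV` of `W^{1,1}_0(Ω)` in `L^{n/(n-1)}(Ω)`, i.e. the optimal
constant in `‖v‖_{n/(n-1)} ≤ C ‖Dv‖_1` for `v ∈ W^{1,1}_0(Ω)`. -/
def embeddingConst (Ω : Set (EuclideanSpace ℝ (Fin n))) : ℝ :=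
  sInf {C : ℝ | 0 ≤ C ∧ ∀ v g, MemW110 Ω v g →
    eLpNorm v (critExponent n) (volume.restrict Ω) ≤
      ENNReal.ofReal C * eLpNorm g 1 (volume.restrict Ω)}

/-- The divergence of a vector field. -/
def divergence (φ : EuclideanSpace ℝ (Fin n) → EuclideanSpace ℝ (Fin n))
    (x : EuclideanSpace ℝ (Fin n)) : ℝ :=
  ∑ i, (fderiv ℝ φ x (EuclideanSpace.single i 1)) i

/-- The total variation `|Dw|(U) ∈ [0, ∞]` of a locally integrable function `w` on an open set
`U`: the supremum of `∫_U w div φ` over all `φ ∈ C_c^1(U; ℝⁿ)` with `|φ| ≤ 1`. -/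
def totalVariation (U : Set (EuclideanSpace ℝ (Fin n)))
    (w : EuclideanSpace ℝ (Fin n) → ℝ) : ℝ≥0∞ :=
  ⨆ (φ : EuclideanSpace ℝ (Fin n) → EuclideanSpace ℝ (Fin n))
    (_ : ContDiff ℝ 1 φ ∧ HasCompactSupport φ ∧ tsupport φ ⊆ U ∧ ∀ x, ‖φ x‖ ≤ 1),
    ENNReal.ofReal (∫ x in U, w x * divergence φ x)

/-- `v ∈ BV(Ω)`: `v` is integrable on `Ω` and has finite total variation there. -/
def MemBV (Ω : Set (EuclideanSpace ℝ (Fin n))) (v : EuclideanSpace ℝ (Fin n) → ℝ) : Prop :=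
  IntegrableOn v Ω ∧ totalVariation Ω v ≠ ⊤

open Classical in
/-- The functional `E_TV`: on `BV(Ω)` it is the total variation on `ℝⁿ` of the extension of `v`
by zero, and it is `∞` outside of `BV(Ω)`. -/
def energyTV (Ω : Set (EuclideanSpace ℝ (Fin n))) (v : EuclideanSpace ℝ (Fin n) → ℝ) : ℝ≥0∞ :=
  if MemBV Ω v then totalVariation univ (Ω.indicator v) else ⊤

/-- The functional `G_1(v) = ∫_Ω |v| dx`. -/
def massG (Ω : Set (EuclideanSpace ℝ (Fin n))) (v : EuclideanSpace ℝ (Fin n) → ℝ) : ℝ :=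
  ∫ x in Ω, |v x|

end Domain

open Classical in
/-- The indicator function of a set in the sense of convex analysis: `0` on `A`, `∞` elsewhere. -/
def indicatorFun {X : Type*} (A : Set X) (v : X) : EReal := if v ∈ A then 0 else ⊤

/-- The functional `E_TV + E_Per + I_{G_1 = α}` on `L^p(Ω)`, with values in `(-∞, ∞]`. -/
def totalEnergy {n : ℕ} {p : ℝ} (Ω : Set (EuclideanSpace ℝ (Fin n)))
    (EPer : Lp ℝ (ENNReal.ofReal p) (volume.restrict Ω) → ℝ) (α : ℝ)
    (v : Lp ℝ (ENNReal.ofReal p) (volume.restrict Ω)) : EReal :=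
  ((energyTV Ω v : ℝ≥0∞) : EReal) + ((EPer v : ℝ) : EReal) +
    indicatorFun {w : Lp ℝ (ENNReal.ofReal p) (volume.restrict Ω) | massG Ω w = α} v

end

/-! Sublevel sets of the energy are precompact in `L^p(Ω)`, so any sequence along which the energy
converges to a real number already has a convergent subsequence.

*Coercivity.* Along such a sequence `‖u‖₁ = α`, and `TV + EPer` is bounded above, where `TV` is the
total variation of the extension by zero. If `EPer` is bounded below, then `TV` is bounded. Otherwise
interpolation of `L^p` between `L^1` and `L^{n/(n-1)}`, together with the Sobolev inequality in `BV`
with constant `C_BV`, gives `|EPer| ≤ κ TV ^ (n (p - 1))` with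
`κ = CPer α ^ (n - (n - 1) p) C_BV ^ (n (p - 1)) < 1` and `n (p - 1) ≤ 1`, which again bounds `TV`
(`exists_totalVariation_le_of_totalEnergy_lt`).

*Sobolev inequality in `BV`.* Both sides of the inequality scale in the same way, so the constant
of `W^{1,1}_0(Ω)` serves for all test functions on `ℝⁿ`
(`IsTestFunction.eLpNorm_critExponent_le_embeddingConst`). Mollification does not increase the total
variation (`eLpNorm_gradient_mollify_le`), so the inequality passes to compactly supported functions
of bounded variation by Fatou's lemma.

*Compactness.* In `L^1`, a mollification at scale `r` is within `r TV` of the original function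
(`eLpNorm_mollify_sub_le`), while the mollifications at a fixed scale form a totally bounded set of
continuous functions by the Arzelà-Ascoli theorem. Total boundedness in `L^1` carries over to `L^p`
by interpolation with the bound in `L^{n/(n-1)}` (`totallyBounded_setOf_totalVariation_le`). -/

/-! ### The critical exponent, interpolation and the Gagliardo-Nirenberg-Sobolev inequality -/

theorem critExponent_one : critExponent 1 = ⊤ := by
  simp [critExponent]

theorem critExponent_of_two_le {n : ℕ} (hn : 2 ≤ n) :
    critExponent n = ENNReal.ofReal ((n : ℝ) / ((n : ℝ) - 1)) := by
  have h2 : (2 : ℝ) ≤ n := by exact_mod_cast hn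
  rw [critExponent, ENNReal.ofReal_div_of_pos (by linarith), ENNReal.ofReal_sub _ zero_le_one,
    ENNReal.ofReal_natCast, ENNReal.ofReal_one]

theorem one_div_critExponent_toReal {n : ℕ} (hn : 1 ≤ n) :
    (1 / critExponent n).toReal = ((n : ℝ) - 1) / n := by
  rcases hn.eq_or_lt with rfl | hn
  · simp [critExponent_one]
  · have h2 : (2 : ℝ) ≤ n := by exact_mod_cast hn
    rw [critExponent_of_two_le hn, one_div, ENNReal.toReal_inv,
      ENNReal.toReal_ofReal (div_nonneg (by linarith) (by linarith)), inv_div]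

/-- The exponent of `‖f‖₁` in the interpolation inequality below is positive exactly because `p`
is subcritical. -/
theorem interpolation_exponent_pos {n : ℕ} (hn : 1 ≤ n) {p : ℝ}
    (hpn : ENNReal.ofReal p < critExponent n) : 0 < (n : ℝ) - ((n : ℝ) - 1) * p := by
  rcases hn.eq_or_lt with rfl | hn
  · simp
  · have h2 : (2 : ℝ) ≤ n := by exact_mod_cast hn
    rw [critExponent_of_two_le hn] at hpn
    have h := (ENNReal.ofReal_lt_ofReal_iff (div_pos (by linarith) (by linarith))).1 hpn
    rw [lt_div_iff₀ (by linarith)] at h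
    linarith

/-- Interpolation of `L^p` between `L^1` and `L^{n/(n-1)}`; the exponents add up to `p`. -/
theorem eLpNorm_rpow_le_mul_eLpNorm_critExponent {X F : Type*} [MeasurableSpace X] {μ : Measure X}
    [NormedAddCommGroup F] {n : ℕ} (hn : 1 ≤ n) {p : ℝ} (hp : 1 < p)
    (hpn : ENNReal.ofReal p < critExponent n) {f : X → F} (hf : AEStronglyMeasurable f μ) :
    eLpNorm f (ENNReal.ofReal p) μ ^ p ≤ eLpNorm f 1 μ ^ ((n : ℝ) - ((n : ℝ) - 1) * p) *
      eLpNorm f (critExponent n) μ ^ ((p - 1) * n) := by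
  have hp0 : 0 < p := by linarith
  rw [eLpNorm_eq_lintegral_rpow_enorm_toReal (by simpa using hp0) ENNReal.ofReal_ne_top,
    ENNReal.toReal_ofReal hp0.le, ← ENNReal.rpow_mul, one_div, inv_mul_cancel₀ hp0.ne',
    ENNReal.rpow_one, eLpNorm_one_eq_lintegral_enorm]
  rcases hn.eq_or_lt with rfl | hn
  · simp only [Nat.cast_one, sub_self, zero_mul, sub_zero, ENNReal.rpow_one, mul_one,
      critExponent_one, eLpNorm_exponent_top]
    rw [← lintegral_mul_const'' _ hf.enorm]
    refine lintegral_mono_ae ?_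
    filter_upwards [enorm_ae_le_eLpNormEssSup f μ] with x hx
    calc ‖f x‖ₑ ^ p = ‖f x‖ₑ ^ (1 + (p - 1)) := by ring_nf
      _ = ‖f x‖ₑ * ‖f x‖ₑ ^ (p - 1) := by
        rw [ENNReal.rpow_add_of_nonneg _ _ zero_le_one (by linarith), ENNReal.rpow_one]
      _ ≤ _ := by gcongr
  · have h2 : (2 : ℝ) ≤ n := by exact_mod_cast hn
    have ha := interpolation_exponent_pos hn.le hpn
    have hq : 0 < (n : ℝ) / ((n : ℝ) - 1) := div_pos (by linarith) (by linarith)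
    rw [critExponent_of_two_le hn, eLpNorm_eq_lintegral_rpow_enorm_toReal (by simpa using hq)
      ENNReal.ofReal_ne_top, ENNReal.toReal_ofReal hq.le, ← ENNReal.rpow_mul]
    have hb : 1 / ((n : ℝ) / ((n : ℝ) - 1)) * ((p - 1) * n) = (n - 1) * (p - 1) := by
      field_simp
    rw [hb]
    have h := ENNReal.lintegral_mul_norm_pow_le (μ := μ) (f := fun x => ‖f x‖ₑ)
      (g := fun x => ‖f x‖ₑ ^ ((n : ℝ) / ((n : ℝ) - 1))) hf.enorm (hf.enorm.pow_const _)
      (p := (n : ℝ) - ((n : ℝ) - 1) * p) (q := (n - 1) * (p - 1)) ha.le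
      (mul_nonneg (by linarith) (by linarith)) (by ring)
    refine le_trans (le_of_eq (lintegral_congr fun x => ?_)) h
    rw [← ENNReal.rpow_mul, ← ENNReal.rpow_add_of_nonneg _ _ ha.le
      (mul_nonneg hq.le (mul_nonneg (by linarith) (by linarith)))]
    congr 1
    have : (n : ℝ) - 1 ≠ 0 := by linarith
    field_simp
    ring

theorem norm_gradient_eq_norm_fderiv {E : Type*} [NormedAddCommGroup E] [InnerProductSpace ℝ E]
    [CompleteSpace E] (φ : E → ℝ) (x : E) : ‖gradient φ x‖ = ‖fderiv ℝ φ x‖ := by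
  simp [gradient]

theorem eLpNorm_gradient_eq {E : Type*} [NormedAddCommGroup E] [InnerProductSpace ℝ E]
    [CompleteSpace E] [MeasurableSpace E] (φ : E → ℝ) (q : ℝ≥0∞) (μ : Measure E) :
    eLpNorm (gradient φ) q μ = eLpNorm (fderiv ℝ φ) q μ :=
  eLpNorm_congr_norm_ae (Eventually.of_forall fun x => norm_gradient_eq_norm_fderiv φ x)

/-- In dimension one a compactly supported function is bounded by the integral of its derivative. -/
theorem eLpNorm_top_le_eLpNorm_fderiv_one {φ : EuclideanSpace ℝ (Fin 1) → ℝ}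
    (hφ : ContDiff ℝ 1 φ) (h'φ : HasCompactSupport φ) :
    eLpNorm φ ⊤ volume ≤ eLpNorm (fderiv ℝ φ) 1 volume := by
  let e : EuclideanSpace ℝ (Fin 1) := EuclideanSpace.single 0 1
  have he : ‖e‖ = 1 := by simp [e]
  let ι : ℝ → EuclideanSpace ℝ (Fin 1) := fun t => t • e
  have hmp : MeasurePreserving ι volume volume := by
    have h := (EuclideanSpace.volume_preserving_symm_measurableEquiv_toLp (Fin 1)).symm.comp
      (volume_preserving_funUnique (Fin 1) ℝ).symm
    convert! h using 1
    ext t i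
    simp [ι, e, Subsingleton.elim i 0]
  have hι : ∀ t, HasDerivAt ι e t := fun t => by
    simpa using (hasDerivAt_id t).smul_const e
  have hcl : IsClosedEmbedding ι := by
    refine Isometry.isClosedEmbedding (Isometry.of_dist_eq fun s t => ?_)
    rw [dist_eq_norm, ← sub_smul, norm_smul, he, mul_one, Real.dist_eq, Real.norm_eq_abs]
  have hval : ∀ x, ι (x 0) = x := by
    intro x
    ext i
    simp [ι, e, Subsingleton.elim i 0]
  rw [eLpNorm_exponent_top]
  refine eLpNormEssSup_le_of_ae_enorm_bound (Eventually.of_forall fun x => ?_)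
  have h1 := HasCompactSupport.enorm_le_lintegral_Ici_deriv (f := φ ∘ ι)
    (hφ.comp (contDiff_id.smul contDiff_const)) (h'φ.comp_isClosedEmbedding hcl) (x 0)
  rw [Function.comp_apply, hval] at h1
  refine h1.trans ((lintegral_mono_set (subset_univ _)).trans ?_)
  rw [setLIntegral_univ, eLpNorm_one_eq_lintegral_enorm,
    ← hmp.lintegral_comp_emb hcl.measurableEmbedding]
  refine lintegral_mono fun t => ?_
  rw [((hφ.differentiable one_ne_zero _).hasFDerivAt.comp_hasDerivAt t (hι t)).deriv]
  rw [← ofReal_norm, ← ofReal_norm]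
  refine ENNReal.ofReal_le_ofReal ((ContinuousLinearMap.le_opNorm _ _).trans ?_)
  rw [he, mul_one]

/-- The Gagliardo-Nirenberg-Sobolev inequality with exponent `1`, including dimension one. -/
theorem exists_eLpNorm_critExponent_le {n : ℕ} (hn : 1 ≤ n) : ∃ C : ℝ, 0 ≤ C ∧
    ∀ φ : EuclideanSpace ℝ (Fin n) → ℝ, ContDiff ℝ 1 φ → HasCompactSupport φ →
      eLpNorm φ (critExponent n) volume ≤ ENNReal.ofReal C * eLpNorm (gradient φ) 1 volume := by
  rcases hn.eq_or_lt with rfl | hn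
  · refine ⟨1, zero_le_one, fun φ hφ h'φ => ?_⟩
    rw [critExponent_one, ENNReal.ofReal_one, one_mul, eLpNorm_gradient_eq]
    exact eLpNorm_top_le_eLpNorm_fderiv_one hφ h'φ
  · have h2 : (2 : ℝ) ≤ n := by exact_mod_cast hn
    refine ⟨eLpNormLESNormFDerivOneConst (volume : Measure (EuclideanSpace ℝ (Fin n)))
      ((n : ℝ) / (n - 1)).toNNReal, NNReal.coe_nonneg _, fun φ hφ h'φ => ?_⟩
    rw [critExponent_of_two_le hn, eLpNorm_gradient_eq, ENNReal.ofReal_coe_nnreal]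
    refine eLpNorm_le_eLpNorm_fderiv_one volume hφ h'φ ?_
    have h1 : (1 : ℝ) < n := by linarith
    rw [finrank_euclideanSpace_fin, ← NNReal.holderConjugate_coe_iff,
      Real.coe_toNNReal _ (div_nonneg (by linarith) (by linarith)), NNReal.coe_natCast]
    exact Real.HolderConjugate.conjExponent h1

/-! ### Test functions and the embedding constant -/

section

theorem ContDiff.continuous_gradient {E : Type*} [NormedAddCommGroup E]
    [InnerProductSpace ℝ E] [CompleteSpace E] {φ : E → ℝ} (hφ : ContDiff ℝ 1 φ) :
    Continuous (gradient φ) :=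
  (InnerProductSpace.toDual ℝ E).symm.continuous.comp (hφ.continuous_fderiv one_ne_zero)

theorem tsupport_gradient_subset {E : Type*} [NormedAddCommGroup E]
    [InnerProductSpace ℝ E] [CompleteSpace E] (φ : E → ℝ) :
    tsupport (gradient φ) ⊆ tsupport φ := by
  refine (closure_mono fun x hx => ?_).trans (tsupport_fderiv_subset ℝ (f := φ))
  simp only [Function.mem_support, ne_eq, gradient] at hx ⊢
  exact fun h => hx (by simp [h])

namespace IsTestFunction

variable {n : ℕ} {Ω : Set (EuclideanSpace ℝ (Fin n))} {φ : EuclideanSpace ℝ (Fin n) → ℝ}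

theorem contDiff_one (h : IsTestFunction Ω φ) : ContDiff ℝ 1 φ := h.1.of_le (by simp)

theorem continuous_gradient (h : IsTestFunction Ω φ) : Continuous (gradient φ) :=
  ContDiff.continuous_gradient h.contDiff_one

theorem hasCompactSupport_gradient (h : IsTestFunction Ω φ) : HasCompactSupport (gradient φ) :=
  h.2.1.mono' (subset_closure.trans (tsupport_gradient_subset φ))

theorem eq_zero_of_notMem (h : IsTestFunction Ω φ) {x : EuclideanSpace ℝ (Fin n)} (hx : x ∉ Ω) :
    φ x = 0 :=
  image_eq_zero_of_notMem_tsupport fun hx' => hx (h.2.2 hx')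

theorem gradient_eq_zero_of_notMem (h : IsTestFunction Ω φ) {x : EuclideanSpace ℝ (Fin n)}
    (hx : x ∉ Ω) : gradient φ x = 0 :=
  image_eq_zero_of_notMem_tsupport fun hx' => hx (h.2.2 (tsupport_gradient_subset φ hx'))

theorem hasWeakGradient (h : IsTestFunction Ω φ) : HasWeakGradient Ω φ (gradient φ) := by
  intro ψ hψ
  rw [setIntegral_eq_integral_of_forall_compl_eq_zero
      fun x hx => by rw [h.eq_zero_of_notMem hx, zero_smul],
    setIntegral_eq_integral_of_forall_compl_eq_zero
      fun x hx => by rw [hψ.eq_zero_of_notMem hx, zero_smul]]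
  have hi1 : Integrable fun x => φ x • gradient ψ x :=
    (h.1.continuous.smul hψ.continuous_gradient).integrable_of_hasCompactSupport h.2.1.smul_right
  have hi2 : Integrable fun x => ψ x • gradient φ x :=
    (hψ.1.continuous.smul h.continuous_gradient).integrable_of_hasCompactSupport hψ.2.1.smul_right
  refine ext_inner_left ℝ fun e => ?_
  rw [inner_neg_right, ← integral_inner hi1, ← integral_inner hi2]
  have e1 : ∀ (f g : EuclideanSpace ℝ (Fin n) → ℝ) x,
      inner ℝ e (f x • gradient g x) = f x * fderiv ℝ g x e := by
    intro f g x
    rw [inner_smul_right, real_inner_comm, inner_gradient_left]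
  have hc : ∀ {f g : EuclideanSpace ℝ (Fin n) → ℝ}, IsTestFunction Ω f → IsTestFunction Ω g →
      Integrable (fun x => f x * fderiv ℝ g x e) := fun hf hg =>
    (hf.1.continuous.mul ((hg.contDiff_one.continuous_fderiv one_ne_zero).clm_apply
      continuous_const)).integrable_of_hasCompactSupport hf.2.1.mul_right
  simp_rw [e1]
  rw [integral_mul_fderiv_eq_neg_fderiv_mul_of_integrable ?_ (hc h hψ)
    ((h.1.continuous.mul hψ.1.continuous).integrable_of_hasCompactSupport h.2.1.mul_right)
    (fun x _ => h.contDiff_one.differentiable one_ne_zero x)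
    (fun x _ => hψ.contDiff_one.differentiable one_ne_zero x)]
  · simp_rw [mul_comm (ψ _)]
  · simpa only [mul_comm] using hc hψ h

theorem memW110 (h : IsTestFunction Ω φ) : MemW110 Ω φ (gradient φ) where
  memLp := (h.1.continuous.memLp_of_hasCompactSupport h.2.1).restrict _
  memLp_gradient :=
    (h.continuous_gradient.memLp_of_hasCompactSupport h.hasCompactSupport_gradient).restrict _
  hasWeakGradient := h.hasWeakGradient
  exists_approx := ⟨fun _ => φ, fun _ => h, by simp, by simp⟩

end IsTestFunction

variable {n : ℕ} {Ω : Set (EuclideanSpace ℝ (Fin n))}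

/-- A Sobolev inequality for test functions extends to `W^{1,1}_0` by Fatou's lemma. -/
theorem MemW110.eLpNorm_le_of_forall_isTestFunction {q C : ℝ≥0∞} (hC : C ≠ ⊤)
    (H : ∀ φ, IsTestFunction Ω φ → eLpNorm φ q (volume.restrict Ω) ≤
      C * eLpNorm (gradient φ) 1 (volume.restrict Ω))
    {v : EuclideanSpace ℝ (Fin n) → ℝ} {g : EuclideanSpace ℝ (Fin n) → EuclideanSpace ℝ (Fin n)}
    (h : MemW110 Ω v g) :
    eLpNorm v q (volume.restrict Ω) ≤ C * eLpNorm g 1 (volume.restrict Ω) := by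
  obtain ⟨φ, hφ, hφv, hφg⟩ := h.exists_approx
  obtain ⟨ns, hns, hae⟩ := (tendstoInMeasure_of_tendsto_eLpNorm one_ne_zero
    (fun k => (hφ k).1.continuous.aestronglyMeasurable) h.memLp.1 hφv).exists_seq_tendsto_ae
  have hlim : Tendsto (fun k => C * (eLpNorm (fun x => gradient (φ (ns k)) x - g x) 1
      (volume.restrict Ω) + eLpNorm g 1 (volume.restrict Ω))) atTop
      (𝓝 (C * eLpNorm g 1 (volume.restrict Ω))) := by
    have := ((hφg.comp hns.tendsto_atTop).add_const (eLpNorm g 1 (volume.restrict Ω)))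
    rw [zero_add] at this
    exact ENNReal.Tendsto.const_mul this (Or.inr hC)
  rw [← hlim.liminf_eq]
  refine (Lp.eLpNorm_lim_le_liminf_eLpNorm
    (fun k => (hφ (ns k)).1.continuous.aestronglyMeasurable) v hae).trans ?_
  refine liminf_le_liminf (Eventually.of_forall fun k => ?_)
  refine (H _ (hφ (ns k))).trans ?_
  gcongr
  refine le_trans (le_of_eq ?_) (eLpNorm_add_le
    ((hφ (ns k)).continuous_gradient.aestronglyMeasurable.sub h.memLp_gradient.1)
    h.memLp_gradient.1 le_rfl)
  congr 1
  ext1 x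
  simp

theorem embeddingConst_nonneg (Ω : Set (EuclideanSpace ℝ (Fin n))) : 0 ≤ embeddingConst Ω :=
  Real.sInf_nonneg fun _ h => h.1

/-- The infimum in `embeddingConst` is over a nonempty set and is attained. -/
theorem MemW110.eLpNorm_critExponent_le (hn : 1 ≤ n)
    {v : EuclideanSpace ℝ (Fin n) → ℝ} {g : EuclideanSpace ℝ (Fin n) → EuclideanSpace ℝ (Fin n)}
    (h : MemW110 Ω v g) :
    eLpNorm v (critExponent n) (volume.restrict Ω) ≤
      ENNReal.ofReal (embeddingConst Ω) * eLpNorm g 1 (volume.restrict Ω) := by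
  set S := {C : ℝ | 0 ≤ C ∧ ∀ v g, MemW110 Ω v g →
    eLpNorm v (critExponent n) (volume.restrict Ω) ≤
      ENNReal.ofReal C * eLpNorm g 1 (volume.restrict Ω)} with hS
  have hne : S.Nonempty := by
    obtain ⟨C, hC, H⟩ := exists_eLpNorm_critExponent_le hn
    refine ⟨C, hC, fun v g hv => hv.eLpNorm_le_of_forall_isTestFunction ENNReal.ofReal_ne_top
      fun φ hφ => ?_⟩
    refine (eLpNorm_restrict_le _ _ _ _).trans ((H φ hφ.contDiff_one hφ.2.1).trans_eq ?_)
    rw [eLpNorm_restrict_eq_of_support_subset]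
    intro x hx
    by_contra hxΩ
    exact hx (hφ.gradient_eq_zero_of_notMem hxΩ)
  obtain ⟨u, -, hu, huS⟩ := exists_seq_tendsto_sInf hne ⟨0, fun _ h => h.1⟩
  exact ge_of_tendsto' (ENNReal.Tendsto.mul_const
    ((ENNReal.continuous_ofReal.tendsto _).comp hu) (Or.inr h.memLp_gradient.2.ne))
    fun k => (huS k).2 v g h

theorem eLpNorm_comp_smul_sub {F : Type*} [NormedAddCommGroup F] {f : EuclideanSpace ℝ (Fin n) → F}
    (hf : Continuous f) {c : ℝ} (hc : 0 < c) (a : EuclideanSpace ℝ (Fin n)) (q : ℝ≥0∞) :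
    eLpNorm (fun x => f (c • (x - a))) q volume =
      ENNReal.ofReal ((c ^ n)⁻¹) ^ (1 / q).toReal * eLpNorm f q volume := by
  have h1 : eLpNorm (fun x => f (c • (x - a))) q volume = eLpNorm (fun x => f (c • x)) q volume :=
    eLpNorm_comp_measurePreserving (g := fun x => f (c • x)) (f := fun x => x - a)
      (by fun_prop) (measurePreserving_sub_right volume a)
  have hcn : 0 < (c ^ n)⁻¹ := by positivity
  have h2 := eLpNorm_map_measure (p := q) (μ := (volume : Measure (EuclideanSpace ℝ (Fin n))))
    (f := fun x => c • x) (g := f) hf.aestronglyMeasurable (by fun_prop)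
  rw [Measure.map_addHaar_smul _ hc.ne', finrank_euclideanSpace_fin, abs_of_pos hcn,
    eLpNorm_smul_measure_of_ne_zero (by simpa using hcn)] at h2
  rw [h1]
  exact h2.symm

/-- The Sobolev inequality with exponent `1` is invariant under dilations and translations, so the
embedding constant of any nonempty open set serves for all test functions on the whole space. -/
theorem IsTestFunction.eLpNorm_critExponent_le_embeddingConst (hn : 1 ≤ n) (hΩ : IsOpen Ω)
    (hΩ' : Ω.Nonempty) {φ : EuclideanSpace ℝ (Fin n) → ℝ} (hφ : IsTestFunction univ φ) :
    eLpNorm φ (critExponent n) volume ≤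
      ENNReal.ofReal (embeddingConst Ω) * eLpNorm (gradient φ) 1 volume := by
  obtain ⟨a, ha⟩ := hΩ'
  obtain ⟨r, hr, hrΩ⟩ := Metric.isOpen_iff.1 hΩ a ha
  obtain ⟨R, hR, hRφ⟩ := hφ.2.1.isBounded.subset_ball_lt 0 0
  set c : ℝ := R / r with hc_def
  have hc : 0 < c := by positivity
  let ψ : EuclideanSpace ℝ (Fin n) → ℝ := fun x => φ (c • (x - a))
  have hgrad : gradient ψ = fun x => c • gradient φ (c • (x - a)) := by
    ext1 x
    have h1 : HasFDerivAt (fun x : EuclideanSpace ℝ (Fin n) => c • (x - a))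
        (c • ContinuousLinearMap.id ℝ _) x := ((hasFDerivAt_id x).sub_const a).const_smul c
    have h2 := ((hφ.contDiff_one.differentiable one_ne_zero
      (c • (x - a))).hasFDerivAt.comp x h1).fderiv
    refine ext_inner_right ℝ fun e => ?_
    rw [inner_gradient_left, inner_smul_left, inner_gradient_left]
    change fderiv ℝ (φ ∘ fun x => c • (x - a)) x e = _
    rw [h2]
    simp
  have hsuppball : tsupport ψ ⊆ Metric.ball a r := by
    intro x hx
    have hx' : c • (x - a) ∈ Metric.ball (0 : EuclideanSpace ℝ (Fin n)) R :=
      hRφ (tsupport_comp_subset_preimage φ (f := fun x => c • (x - a)) (by fun_prop) hx)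
    rw [mem_ball_zero_iff, norm_smul, Real.norm_of_nonneg hc.le, hc_def, div_mul_eq_mul_div,
      div_lt_iff₀ hr, mul_lt_mul_iff_right₀ hR] at hx'
    rwa [Metric.mem_ball, dist_eq_norm]
  have hψ : IsTestFunction Ω ψ :=
    ⟨hφ.1.comp (f := fun x => c • (x - a)) (by fun_prop),
      Metric.isCompact_of_isClosed_isBounded (isClosed_tsupport ψ)
        (Metric.isBounded_ball.subset hsuppball), hsuppball.trans hrΩ⟩
  have h := hψ.memW110.eLpNorm_critExponent_le hn
  have hn0 : (n : ℝ) ≠ 0 := by positivity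
  have hs1 : Function.support ψ ⊆ Ω := fun x hx => by
    by_contra hxΩ
    exact hx (hψ.eq_zero_of_notMem hxΩ)
  have hs2 : Function.support (gradient ψ) ⊆ Ω := fun x hx => by
    by_contra hxΩ
    exact hx (hψ.gradient_eq_zero_of_notMem hxΩ)
  have e1 : gradient ψ = c • fun x => gradient φ (c • (x - a)) := hgrad
  rw [eLpNorm_restrict_eq_of_support_subset hs1, eLpNorm_restrict_eq_of_support_subset hs2, e1,
    eLpNorm_comp_smul_sub hφ.1.continuous hc, one_div_critExponent_toReal hn,
    eLpNorm_const_smul, eLpNorm_comp_smul_sub hφ.continuous_gradient hc] at h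
  -- both sides pick up the same power `c ^ (1 - n)` of the dilation factor
  have hpow : ENNReal.ofReal ((c ^ n)⁻¹) ^ (((n : ℝ) - 1) / n) =
      ‖c‖ₑ * ENNReal.ofReal ((c ^ n)⁻¹) ^ (1 / (1 : ℝ≥0∞)).toReal := by
    rw [ENNReal.ofReal_rpow_of_pos (by positivity), Real.enorm_eq_ofReal hc.le, div_one,
      ENNReal.toReal_one, ENNReal.rpow_one, ← ENNReal.ofReal_mul hc.le]
    congr 1
    rw [← Real.rpow_natCast, ← Real.rpow_neg hc.le, ← Real.rpow_mul hc.le]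
    nth_rw 2 [← Real.rpow_one c]
    rw [← Real.rpow_add hc]
    congr 1
    field_simp
    ring
  have hpos : ‖c‖ₑ * ENNReal.ofReal ((c ^ n)⁻¹) ^ (1 / (1 : ℝ≥0∞)).toReal ≠ 0 := by
    simp [hc.ne', hc]
  have hfin : ‖c‖ₑ * ENNReal.ofReal ((c ^ n)⁻¹) ^ (1 / (1 : ℝ≥0∞)).toReal ≠ ⊤ := by
    simp [ENNReal.mul_eq_top]
  rw [hpow, ← mul_assoc (‖c‖ₑ), mul_left_comm] at h
  exact (ENNReal.mul_le_mul_iff_right hpos hfin).1 h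

end

/-! ### Mollification and total variation -/

section

variable {n : ℕ}

/-- The mollification of `w` by the normalized bump function `ρ`. -/
noncomputable def mollify {F : Type*} [NormedAddCommGroup F] [NormedSpace ℝ F]
    (ρ : ContDiffBump (0 : EuclideanSpace ℝ (Fin n))) (w : EuclideanSpace ℝ (Fin n) → F) :
    EuclideanSpace ℝ (Fin n) → F :=
  convolution (ρ.normed volume) w (ContinuousLinearMap.lsmul ℝ ℝ) volume

theorem mollify_apply {F : Type*} [NormedAddCommGroup F] [NormedSpace ℝ F]
    (ρ : ContDiffBump (0 : EuclideanSpace ℝ (Fin n))) (w : EuclideanSpace ℝ (Fin n) → F)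
    (x : EuclideanSpace ℝ (Fin n)) :
    mollify ρ w x = ∫ t, ρ.normed volume t • w (x - t) := rfl

theorem isTestFunction_mollify (ρ : ContDiffBump (0 : EuclideanSpace ℝ (Fin n)))
    {w : EuclideanSpace ℝ (Fin n) → ℝ} (hw : Integrable w) (h'w : HasCompactSupport w) :
    IsTestFunction univ (mollify ρ w) :=
  ⟨ρ.hasCompactSupport_normed.contDiff_convolution_left _ ρ.contDiff_normed hw.locallyIntegrable,
    ρ.hasCompactSupport_normed.convolution _ h'w, subset_univ _⟩

theorem integrable_normed_smul_comp_sub {F : Type*} [NormedAddCommGroup F] [NormedSpace ℝ F]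
    (ρ : ContDiffBump (0 : EuclideanSpace ℝ (Fin n))) {f : EuclideanSpace ℝ (Fin n) → F}
    (hf : Continuous f) (x : EuclideanSpace ℝ (Fin n)) :
    Integrable fun t => ρ.normed volume t • f (x - t) :=
  Continuous.integrable_of_hasCompactSupport
    (ρ.continuous_normed.smul (hf.comp (continuous_const.sub continuous_id)))
    ρ.hasCompactSupport_normed.smul_right

section VectorField

variable {ψ : EuclideanSpace ℝ (Fin n) → EuclideanSpace ℝ (Fin n)}

theorem hasCompactSupport_mollify {F : Type*} [NormedAddCommGroup F] [NormedSpace ℝ F]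
    (ρ : ContDiffBump (0 : EuclideanSpace ℝ (Fin n)))
    {ψ : EuclideanSpace ℝ (Fin n) → F} (h'ψ : HasCompactSupport ψ) :
    HasCompactSupport (mollify ρ ψ) := ρ.hasCompactSupport_normed.convolution _ h'ψ

theorem contDiff_one_mollify (ρ : ContDiffBump (0 : EuclideanSpace ℝ (Fin n)))
    (hψ : ContDiff ℝ 1 ψ) : ContDiff ℝ 1 (mollify ρ ψ) :=
  ρ.hasCompactSupport_normed.contDiff_convolution_left (n := 1) _ ρ.contDiff_normed
    hψ.continuous.locallyIntegrable

theorem norm_mollify_le (ρ : ContDiffBump (0 : EuclideanSpace ℝ (Fin n)))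
    (hψ1 : ∀ x, ‖ψ x‖ ≤ 1) (x : EuclideanSpace ℝ (Fin n)) : ‖mollify ρ ψ x‖ ≤ 1 := by
  rw [mollify_apply, ← ρ.integral_normed (μ := volume)]
  refine norm_integral_le_of_norm_le ρ.integrable_normed (Eventually.of_forall fun t => ?_)
  rw [norm_smul, Real.norm_of_nonneg (ρ.nonneg_normed t)]
  exact mul_le_of_le_one_right (ρ.nonneg_normed t) (hψ1 _)

theorem continuous_divergence (hψ : ContDiff ℝ 1 ψ) : Continuous (divergence ψ) := by
  have := hψ.continuous_fderiv one_ne_zero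
  unfold divergence
  fun_prop

theorem hasCompactSupport_divergence (h'ψ : HasCompactSupport ψ) :
    HasCompactSupport (divergence ψ) := by
  refine (h'ψ.fderiv ℝ).mono' ((Function.support_subset_iff'.2 fun x hx => ?_).trans subset_closure)
  simp only [Function.mem_support, ne_eq, not_not] at hx
  simp [divergence, hx]

theorem divergence_mollify (ρ : ContDiffBump (0 : EuclideanSpace ℝ (Fin n)))
    (hψ : ContDiff ℝ 1 ψ) (h'ψ : HasCompactSupport ψ) :
    divergence (mollify ρ ψ) = mollify ρ (divergence ψ) := by
  ext1 x
  have h1 := (h'ψ.hasFDerivAt_convolution_right (μ := volume) (f := ρ.normed volume)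
    (ContinuousLinearMap.lsmul ℝ ℝ) ρ.continuous_normed.locallyIntegrable hψ x).fderiv
  have hint : Integrable fun t => ρ.normed volume t • fderiv ℝ ψ (x - t) :=
    integrable_normed_smul_comp_sub ρ (hψ.continuous_fderiv one_ne_zero) x
  have h2 : fderiv ℝ (mollify ρ ψ) x = ∫ t, ρ.normed volume t • fderiv ℝ ψ (x - t) := h1
  have h3 : ∀ i, (fderiv ℝ (mollify ρ ψ) x (EuclideanSpace.single i 1)) i =
      ∫ t, ρ.normed volume t * (fderiv ℝ ψ (x - t) (EuclideanSpace.single i 1)) i := by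
    intro i
    rw [h2]
    exact (((EuclideanSpace.proj i : EuclideanSpace ℝ (Fin n) →L[ℝ] ℝ).comp
      (ContinuousLinearMap.apply ℝ _ (EuclideanSpace.single i (1 : ℝ)))).integral_comp_comm
        hint).symm
  rw [mollify_apply]
  simp only [divergence, h3, smul_eq_mul, Finset.mul_sum]
  rw [integral_finsetSum]
  intro i _
  exact (((EuclideanSpace.proj i : EuclideanSpace ℝ (Fin n) →L[ℝ] ℝ).comp
      (ContinuousLinearMap.apply ℝ _ (EuclideanSpace.single i (1 : ℝ)))).integrable_comp hint)

end VectorField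

/-- Mollification is a symmetric operator. -/
theorem integral_mollify_mul (ρ : ContDiffBump (0 : EuclideanSpace ℝ (Fin n)))
    {w d : EuclideanSpace ℝ (Fin n) → ℝ} (hw : Integrable w) (hd : Continuous d)
    (h'd : HasCompactSupport d) :
    ∫ x, mollify ρ w x * d x = ∫ x, w x * mollify ρ d x := by
  obtain ⟨C, hC⟩ := h'd.exists_bound_of_continuous hd
  have hρ : Integrable (ρ.normed (volume : Measure (EuclideanSpace ℝ (Fin n)))) :=
    ρ.integrable_normed
  have hi1 : Integrable (fun z : EuclideanSpace ℝ (Fin n) × EuclideanSpace ℝ (Fin n) =>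
      ρ.normed volume z.2 * w (z.1 - z.2) * d z.1) (volume.prod volume) :=
    (hρ.convolution_integrand (ContinuousLinearMap.mul ℝ ℝ) hw).mul_bdd (c := C)
      (by fun_prop) (Eventually.of_forall fun z => hC _)
  have hi2 : Integrable (fun z : EuclideanSpace ℝ (Fin n) × EuclideanSpace ℝ (Fin n) =>
      w z.1 * ρ.normed volume z.2 * d (z.1 + z.2)) (volume.prod volume) :=
    (hw.mul_prod hρ).mul_bdd (c := C)
      (by fun_prop) (Eventually.of_forall fun z => hC _)
  calc ∫ x, mollify ρ w x * d x
      = ∫ x, ∫ t, ρ.normed volume t * w (x - t) * d x := by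
        simp_rw [mollify_apply, smul_eq_mul, integral_mul_const]
    _ = ∫ t, ∫ x, ρ.normed volume t * w (x - t) * d x := integral_integral_swap hi1
    _ = ∫ t, ∫ x, w x * ρ.normed volume t * d (x + t) := by
        congr 1
        ext1 t
        rw [← integral_add_right_eq_self _ t]
        simp only [add_sub_cancel_right]
        simp_rw [mul_comm (w _)]
    _ = ∫ x, ∫ t, w x * ρ.normed volume t * d (x + t) := (integral_integral_swap hi2).symm
    _ = ∫ x, w x * mollify ρ d x := by
        congr 1
        ext1 x
        -- the bump function is even
        rw [mollify_apply, ← integral_const_mul, ← integral_neg_eq_self]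
        simp only [ρ.normed_neg, smul_eq_mul, mul_assoc, sub_eq_add_neg]

theorem integral_inner_gradient_eq_neg {g : EuclideanSpace ℝ (Fin n) → ℝ}
    {ψ : EuclideanSpace ℝ (Fin n) → EuclideanSpace ℝ (Fin n)} (hg : ContDiff ℝ 1 g)
    (hψ : ContDiff ℝ 1 ψ) (h'ψ : HasCompactSupport ψ) :
    ∫ x, inner ℝ (gradient g x) (ψ x) = - ∫ x, g x * divergence ψ x := by
  have hψi : ∀ i, ContDiff ℝ 1 (fun x => ψ x i) := fun i =>
    (EuclideanSpace.proj i : EuclideanSpace ℝ (Fin n) →L[ℝ] ℝ).contDiff.comp hψ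
  have h'ψi : ∀ i, HasCompactSupport (fun x => ψ x i) := fun i =>
    h'ψ.comp_left (g := fun y : EuclideanSpace ℝ (Fin n) => y i) rfl
  have hfd : ∀ i x e, fderiv ℝ (fun x => ψ x i) x e = (fderiv ℝ ψ x e) i := by
    intro i x e
    have := ((EuclideanSpace.proj i : EuclideanSpace ℝ (Fin n) →L[ℝ] ℝ).hasFDerivAt.comp x
      (hψ.differentiable one_ne_zero x).hasFDerivAt).fderiv
    change fderiv ℝ ((EuclideanSpace.proj i : EuclideanSpace ℝ (Fin n) →L[ℝ] ℝ) ∘ ψ) x e = _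
    rw [this]
    rfl
  have hg' := hg.continuous_fderiv one_ne_zero
  have hgc := hg.continuous
  have hi1 : ∀ i, Integrable fun x => fderiv ℝ g x (EuclideanSpace.single i 1) * ψ x i := fun i =>
    (Continuous.mul (by fun_prop) (hψi i).continuous).integrable_of_hasCompactSupport
      (h'ψi i).mul_left
  have hi2 : ∀ i, Integrable fun x =>
      g x * fderiv ℝ (fun x => ψ x i) x (EuclideanSpace.single i 1) := fun i =>
    (hgc.mul (((hψi i).continuous_fderiv one_ne_zero).clm_apply
      continuous_const)).integrable_of_hasCompactSupport
      (((h'ψi i).fderiv_apply ℝ _).mul_left)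
  have hinner : ∀ x, inner ℝ (gradient g x) (ψ x) =
      ∑ i, fderiv ℝ g x (EuclideanSpace.single i 1) * ψ x i := by
    intro x
    rw [inner_gradient_left]
    conv_lhs => rw [← (EuclideanSpace.basisFun (Fin n) ℝ).sum_repr (ψ x)]
    simp [mul_comm]
  simp_rw [hinner, divergence, Finset.mul_sum, ← hfd]
  rw [integral_finsetSum _ fun i _ => hi1 i, integral_finsetSum _ fun i _ => hi2 i,
    ← Finset.sum_neg_distrib]
  refine Finset.sum_congr rfl fun i _ => ?_
  rw [integral_mul_fderiv_eq_neg_fderiv_mul_of_integrable (hi1 i) (hi2 i)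
    ((hgc.mul (hψi i).continuous).integrable_of_hasCompactSupport (h'ψi i).mul_left)
    (fun x _ => hg.differentiable one_ne_zero x)
    (fun x _ => (hψi i).differentiable one_ne_zero x), neg_neg]

/-- Mollification does not increase the total variation. The fields `-G / √(‖G‖² + η²)`, with `G`
the gradient of the mollification, are smooth substitutes for `-G / ‖G‖`; their mollifications
are admissible in the definition of the total variation. -/
theorem eLpNorm_gradient_mollify_le (ρ : ContDiffBump (0 : EuclideanSpace ℝ (Fin n)))
    {w : EuclideanSpace ℝ (Fin n) → ℝ} (hw : Integrable w) (h'w : HasCompactSupport w) :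
    eLpNorm (gradient (mollify ρ w)) 1 volume ≤ totalVariation univ w := by
  set g := mollify ρ w with hg_def
  have hg : IsTestFunction univ g := isTestFunction_mollify ρ hw h'w
  set G := gradient g with hG_def
  have hG : ContDiff ℝ 1 G :=
    (InnerProductSpace.toDual ℝ (EuclideanSpace ℝ (Fin n))).symm.toContinuousLinearEquiv.contDiff.comp
      ((contDiff_infty_iff_fderiv.1 hg.1).2.of_le (by simp))
  have h'G : HasCompactSupport G := hg.hasCompactSupport_gradient
  have hGi : Integrable G := hG.continuous.integrable_of_hasCompactSupport h'G
  have key : ∀ η : ℝ, 0 < η →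
      ENNReal.ofReal ((∫ x, ‖G x‖) - η * (volume (tsupport G)).toReal) ≤ totalVariation univ w := by
    intro η hη
    have hpos : ∀ x, 0 < ‖G x‖ ^ 2 + η ^ 2 := fun x => by positivity
    have hsqrt : ∀ x, ‖G x‖ ≤ √(‖G x‖ ^ 2 + η ^ 2) := fun x =>
      Real.le_sqrt_of_sq_le (by nlinarith)
    let ψ : EuclideanSpace ℝ (Fin n) → EuclideanSpace ℝ (Fin n) :=
      fun x => -((√(‖G x‖ ^ 2 + η ^ 2))⁻¹ • G x)
    have hψ : ContDiff ℝ 1 ψ := by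
      refine ((ContDiff.inv (ContDiff.sqrt ((hG.norm_sq ℝ).add contDiff_const)
        fun x => (hpos x).ne') fun x => ?_).smul hG).neg
      exact (Real.sqrt_pos.2 (hpos x)).ne'
    have h'ψ : HasCompactSupport ψ := by
      refine h'G.mono fun x hx hx0 => hx ?_
      simp [ψ, hx0]
    have hψ1 : ∀ x, ‖ψ x‖ ≤ 1 := by
      intro x
      rw [norm_neg, norm_smul, norm_inv, Real.norm_of_nonneg (Real.sqrt_nonneg _), inv_mul_eq_div]
      exact div_le_one_of_le₀ (hsqrt x) (Real.sqrt_nonneg _)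
    have hTV : ENNReal.ofReal (∫ x in univ, w x * divergence (mollify ρ ψ) x) ≤
        totalVariation univ w :=
      le_iSup₂_of_le (mollify ρ ψ) ⟨contDiff_one_mollify ρ hψ, hasCompactSupport_mollify ρ h'ψ,
        subset_univ _, norm_mollify_le ρ hψ1⟩ le_rfl
    refine le_trans (ENNReal.ofReal_le_ofReal ?_) hTV
    rw [setIntegral_univ, divergence_mollify ρ hψ h'ψ, ← integral_mollify_mul ρ hw
      (continuous_divergence hψ) (hasCompactSupport_divergence h'ψ), ← hg_def,
      ← neg_neg (∫ x, g x * divergence ψ x), ← integral_inner_gradient_eq_neg hg.contDiff_one hψ h'ψ,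
      ← integral_neg, ← hG_def]
    have hfin : volume (tsupport G) ≠ ⊤ := h'G.isCompact.measure_lt_top.ne
    have hind : Integrable ((tsupport G).indicator fun _ => η) :=
      (integrable_indicator_iff (isClosed_tsupport G).measurableSet).2 (integrableOn_const hfin)
    have hη_int : ∫ x, (tsupport G).indicator (fun _ => η) x = η * (volume (tsupport G)).toReal := by
      rw [integral_indicator_const _ (isClosed_tsupport G).measurableSet, smul_eq_mul, mul_comm]
      rfl
    rw [← hη_int, ← integral_sub hGi.norm hind]
    refine integral_mono (hGi.norm.sub hind) ?_ fun x => ?_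
    · exact ((hG.continuous.inner hψ.continuous).integrable_of_hasCompactSupport
        (h'G.mono fun x hx hx0 => hx (by simp [hx0]))).neg
    · by_cases hx : x ∈ tsupport G
      · simp only [ψ, inner_neg_right, neg_neg, inner_smul_right, real_inner_self_eq_norm_sq,
          indicator_of_mem hx]
        have hs := Real.sqrt_pos.2 (hpos x)
        rw [inv_mul_eq_div, le_div_iff₀ hs]
        have h1 : √(‖G x‖ ^ 2 + η ^ 2) ≤ ‖G x‖ + η :=
          Real.sqrt_le_iff.2 ⟨by positivity, by nlinarith [norm_nonneg (G x)]⟩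
        rcases le_total (‖G x‖) η with h | h
        · nlinarith [mul_nonneg (sub_nonneg.2 h) hs.le, sq_nonneg ‖G x‖]
        · nlinarith [mul_le_mul_of_nonneg_left h1 (sub_nonneg.2 h), sq_nonneg η]
      · have : G x = 0 := image_eq_zero_of_notMem_tsupport hx
        simp [this, indicator_of_notMem hx]
  have hlim : Tendsto (fun η : ℝ =>
      ENNReal.ofReal ((∫ x, ‖G x‖) - η * (volume (tsupport G)).toReal)) (𝓝[>] 0)
      (𝓝 (ENNReal.ofReal (∫ x, ‖G x‖))) := by
    refine (ENNReal.continuous_ofReal.tendsto _).comp ?_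
    have : Continuous fun η : ℝ => (∫ x, ‖G x‖) - η * (volume (tsupport G)).toReal := by fun_prop
    simpa using (this.tendsto 0).mono_left nhdsWithin_le_nhds
  rw [eLpNorm_one_eq_lintegral_enorm, ← ofReal_integral_norm_eq_lintegral_enorm hGi]
  exact le_of_tendsto hlim (eventually_mem_nhdsWithin.mono fun η hη => key η hη)

end

/-! ### Functions of bounded variation: Sobolev inequality and mollification error -/

section

variable {n : ℕ} {w : EuclideanSpace ℝ (Fin n) → ℝ}

/-- The ratio of the two radii stays bounded, as the Lebesgue differentiation theorem requires. -/
theorem exists_contDiffBump_rOut_eq (n : ℕ) {r : ℝ} (hr : 0 < r) :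
    ∃ ρ : ContDiffBump (0 : EuclideanSpace ℝ (Fin n)), ρ.rOut = r ∧ ρ.rOut ≤ 2 * ρ.rIn :=
  ⟨⟨r / 2, r, by positivity, by linarith⟩, rfl, by linarith⟩

theorem exists_seq_ae_tendsto_mollify (hw : Integrable w) :
    ∃ ρ : ℕ → ContDiffBump (0 : EuclideanSpace ℝ (Fin n)),
      ∀ᵐ x, Tendsto (fun k => mollify (ρ k) w x) atTop (𝓝 (w x)) := by
  choose ρ hρ hρ' using fun k : ℕ =>
    exists_contDiffBump_rOut_eq n (r := 1 / ((k : ℝ) + 1)) (by positivity)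
  refine ⟨ρ, ContDiffBump.ae_convolution_tendsto_right_of_locallyIntegrable ?_
    (Eventually.of_forall hρ') hw.locallyIntegrable⟩
  simp_rw [hρ]
  exact tendsto_one_div_add_atTop_nhds_zero_nat

/-- The Sobolev inequality for functions of bounded variation, with the embedding constant
of `W^{1,1}_0(Ω)`. -/
theorem eLpNorm_critExponent_le_totalVariation (hn : 1 ≤ n) {Ω : Set (EuclideanSpace ℝ (Fin n))}
    (hΩ : IsOpen Ω) (hΩ' : Ω.Nonempty) (hw : Integrable w) (h'w : HasCompactSupport w) :
    eLpNorm w (critExponent n) volume ≤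
      ENNReal.ofReal (embeddingConst Ω) * totalVariation univ w := by
  obtain ⟨ρ, hρ⟩ := exists_seq_ae_tendsto_mollify hw
  refine (Lp.eLpNorm_lim_le_liminf_eLpNorm (fun k =>
    (isTestFunction_mollify (ρ k) hw h'w).1.continuous.aestronglyMeasurable) w hρ).trans ?_
  refine liminf_le_of_le (by isBoundedDefault) fun b hb => ?_
  obtain ⟨k, hk⟩ := hb.exists
  refine hk.trans (((isTestFunction_mollify (ρ k) hw
    h'w).eLpNorm_critExponent_le_embeddingConst hn hΩ hΩ').trans ?_)
  gcongr
  exact eLpNorm_gradient_mollify_le (ρ k) hw h'w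

theorem eLpNorm_translate_sub_le_of_contDiff {g : EuclideanSpace ℝ (Fin n) → ℝ}
    (hg : ContDiff ℝ 1 g) (h : EuclideanSpace ℝ (Fin n)) :
    eLpNorm (fun x => g (x + h) - g x) 1 volume ≤ ‖h‖ₑ * eLpNorm (gradient g) 1 volume := by
  have hg' := hg.continuous_fderiv one_ne_zero
  have hpt : ∀ x, ‖g (x + h) - g x‖ₑ ≤ ∫⁻ t in Ioc (0 : ℝ) 1, ‖h‖ₑ * ‖fderiv ℝ g (x + t • h)‖ₑ := by
    intro x
    have hline : ∀ t : ℝ, HasDerivAt (fun t : ℝ => x + t • h) h t := fun t => by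
      simpa using ((hasDerivAt_id t).smul_const h).const_add x
    have hd : ∀ t ∈ uIcc (0 : ℝ) 1,
        HasDerivAt (fun t : ℝ => g (x + t • h)) (fderiv ℝ g (x + t • h) h) t := fun t _ =>
      (hg.differentiable one_ne_zero (x + t • h)).hasFDerivAt.comp_hasDerivAt t (hline t)
    have hftc := intervalIntegral.integral_eq_sub_of_hasDerivAt hd
      (Continuous.intervalIntegrable (by fun_prop) _ _)
    simp only [one_smul, zero_smul, add_zero] at hftc
    rw [← hftc, intervalIntegral.integral_of_le zero_le_one]
    refine (enorm_integral_le_lintegral_enorm _).trans (lintegral_mono fun t => ?_)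
    rw [mul_comm]
    exact ContinuousLinearMap.le_opENorm _ _
  rw [eLpNorm_gradient_eq, eLpNorm_one_eq_lintegral_enorm, eLpNorm_one_eq_lintegral_enorm]
  calc ∫⁻ x, ‖g (x + h) - g x‖ₑ
      ≤ ∫⁻ x, ∫⁻ t in Ioc (0 : ℝ) 1, ‖h‖ₑ * ‖fderiv ℝ g (x + t • h)‖ₑ := lintegral_mono hpt
    _ = ∫⁻ t in Ioc (0 : ℝ) 1, ∫⁻ x, ‖h‖ₑ * ‖fderiv ℝ g (x + t • h)‖ₑ := by
      refine lintegral_lintegral_swap (Measurable.aemeasurable ?_)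
      have hc : Continuous fun z : EuclideanSpace ℝ (Fin n) × ℝ => fderiv ℝ g (z.1 + z.2 • h) := by
        fun_prop
      exact hc.enorm.measurable.const_mul _
    _ = ∫⁻ t in Ioc (0 : ℝ) 1, ‖h‖ₑ * ∫⁻ x, ‖fderiv ℝ g x‖ₑ := by
      refine lintegral_congr fun t => ?_
      rw [lintegral_const_mul' _ _ enorm_ne_top,
        lintegral_add_right_eq_self (fun x => ‖fderiv ℝ g x‖ₑ)]
    _ = ‖h‖ₑ * ∫⁻ x, ‖fderiv ℝ g x‖ₑ := by simp

/-- For functions of bounded variation the translation estimate follows from the smooth case by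
mollification and Fatou's lemma. -/
theorem eLpNorm_translate_sub_le (hw : Integrable w) (h'w : HasCompactSupport w)
    (h : EuclideanSpace ℝ (Fin n)) :
    eLpNorm (fun x => w (x + h) - w x) 1 volume ≤ ‖h‖ₑ * totalVariation univ w := by
  obtain ⟨ρ, hρ⟩ := exists_seq_ae_tendsto_mollify hw
  have hρh : ∀ᵐ x, Tendsto (fun k => mollify (ρ k) w (x + h)) atTop (𝓝 (w (x + h))) :=
    (measurePreserving_add_right volume h).quasiMeasurePreserving.ae hρ
  have hc : ∀ k, Continuous (mollify (ρ k) w) := fun k =>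
    (isTestFunction_mollify (ρ k) hw h'w).1.continuous
  refine (Lp.eLpNorm_lim_le_liminf_eLpNorm (f := fun k x => mollify (ρ k) w (x + h) -
    mollify (ρ k) w x) (fun k => Continuous.aestronglyMeasurable (by have := hc k; fun_prop)) _
      (by filter_upwards [hρ, hρh] with x h1 h2 using h2.sub h1)).trans ?_
  refine liminf_le_of_le (by isBoundedDefault) fun b hb => ?_
  obtain ⟨k, hk⟩ := hb.exists
  refine hk.trans ((eLpNorm_translate_sub_le_of_contDiff
    (isTestFunction_mollify (ρ k) hw h'w).contDiff_one h).trans ?_)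
  gcongr
  exact eLpNorm_gradient_mollify_le (ρ k) hw h'w

theorem integrable_normed_mul_comp_sub (ρ : ContDiffBump (0 : EuclideanSpace ℝ (Fin n)))
    (hw : Integrable w) (x : EuclideanSpace ℝ (Fin n)) :
    Integrable fun t => ρ.normed volume t * w (x - t) := by
  obtain ⟨C, hC⟩ := ρ.hasCompactSupport_normed.exists_bound_of_continuous
    (ρ.continuous_normed (μ := volume))
  exact (hw.comp_sub_left x).bdd_mul (c := C) ρ.continuous_normed.aestronglyMeasurable
    (Eventually.of_forall hC)

/-- Averaging the translation estimate over the support of the mollifier. -/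
theorem eLpNorm_mollify_sub_le (ρ : ContDiffBump (0 : EuclideanSpace ℝ (Fin n)))
    (hw : Integrable w) (h'w : HasCompactSupport w) :
    eLpNorm (fun x => mollify ρ w x - w x) 1 volume ≤
      ENNReal.ofReal ρ.rOut * totalVariation univ w := by
  have hpt : ∀ x, ‖mollify ρ w x - w x‖ₑ ≤
      ∫⁻ t, ENNReal.ofReal (ρ.normed volume t) * ‖w (x + -t) - w x‖ₑ := by
    intro x
    have h1 : mollify ρ w x - w x = ∫ t, ρ.normed volume t * (w (x + -t) - w x) := by
      simp_rw [mul_sub, ← sub_eq_add_neg]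
      rw [integral_sub (integrable_normed_mul_comp_sub ρ hw x) (ρ.integrable_normed.mul_const _),
        integral_mul_const, ρ.integral_normed, one_mul]
      rfl
    rw [h1]
    refine (enorm_integral_le_lintegral_enorm _).trans (lintegral_mono fun t => ?_)
    rw [enorm_mul, Real.enorm_eq_ofReal (ρ.nonneg_normed t)]
  rw [eLpNorm_one_eq_lintegral_enorm]
  calc ∫⁻ x, ‖mollify ρ w x - w x‖ₑ
      ≤ ∫⁻ x, ∫⁻ t, ENNReal.ofReal (ρ.normed volume t) * ‖w (x + -t) - w x‖ₑ := lintegral_mono hpt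
    _ = ∫⁻ t, ∫⁻ x, ENNReal.ofReal (ρ.normed volume t) * ‖w (x + -t) - w x‖ₑ := by
      refine lintegral_lintegral_swap (AEMeasurable.mul ?_ (AEStronglyMeasurable.enorm ?_))
      · have := ρ.continuous_normed (μ := volume)
        exact Measurable.aemeasurable (by fun_prop)
      · refine AEStronglyMeasurable.sub ?_ hw.1.comp_fst
        simp only [← sub_eq_add_neg]
        exact hw.1.comp_quasiMeasurePreserving (quasiMeasurePreserving_sub volume volume)
    _ ≤ ∫⁻ t, ENNReal.ofReal (ρ.normed volume t) *
          (ENNReal.ofReal ρ.rOut * totalVariation univ w) := by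
      refine lintegral_mono fun t => ?_
      rw [lintegral_const_mul' _ _ ENNReal.ofReal_ne_top]
      by_cases ht : t ∈ Metric.ball (0 : EuclideanSpace ℝ (Fin n)) ρ.rOut
      · gcongr
        rw [← eLpNorm_one_eq_lintegral_enorm]
        refine (eLpNorm_translate_sub_le hw h'w (-t)).trans ?_
        gcongr
        rw [enorm_neg, ← ofReal_norm]
        exact ENNReal.ofReal_le_ofReal (mem_ball_zero_iff.1 ht).le
      · rw [← ρ.support_normed_eq (μ := volume), Function.mem_support, not_not] at ht
        simp [ht]
    _ = (∫⁻ t, ENNReal.ofReal (ρ.normed volume t)) *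
          (ENNReal.ofReal ρ.rOut * totalVariation univ w) :=
      lintegral_mul_const _ (ρ.continuous_normed.measurable.ennreal_ofReal)
    _ = ENNReal.ofReal ρ.rOut * totalVariation univ w := by
      rw [← ofReal_integral_eq_lintegral_ofReal ρ.integrable_normed
        (Eventually.of_forall ρ.nonneg_normed), ρ.integral_normed, ENNReal.ofReal_one, one_mul]

theorem integral_norm_le_of_eLpNorm_one_le {a : ℝ≥0} (hw : Integrable w)
    (ha : eLpNorm w 1 volume ≤ a) : ∫ x, ‖w x‖ ≤ a := by
  rw [eLpNorm_one_eq_lintegral_enorm, ← ofReal_integral_norm_eq_lintegral_enorm hw] at ha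
  simpa using ENNReal.ofReal_le_iff_le_toReal ENNReal.coe_ne_top |>.1 ha

theorem norm_mollify_le_of_bound {C : ℝ} (ρ : ContDiffBump (0 : EuclideanSpace ℝ (Fin n)))
    (hC : ∀ x, ‖ρ.normed volume x‖ ≤ C) (hw : Integrable w) (x : EuclideanSpace ℝ (Fin n)) :
    ‖mollify ρ w x‖ ≤ C * ∫ y, ‖w y‖ := by
  rw [mollify_apply, ← integral_sub_left_eq_self _ volume x, ← integral_const_mul]
  refine norm_integral_le_of_norm_le (hw.norm.const_mul C) (Eventually.of_forall fun y => ?_)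
  rw [norm_smul, sub_sub_cancel]
  gcongr
  exact hC _

theorem dist_mollify_le_of_lipschitzWith {L : ℝ≥0}
    (ρ : ContDiffBump (0 : EuclideanSpace ℝ (Fin n)))
    (hL : LipschitzWith L (ρ.normed (volume : Measure (EuclideanSpace ℝ (Fin n)))))
    (hw : Integrable w) (x y : EuclideanSpace ℝ (Fin n)) :
    dist (mollify ρ w x) (mollify ρ w y) ≤ (L * ∫ z, ‖w z‖) * dist x y := by
  have h : ∀ x, mollify ρ w x = ∫ z, ρ.normed volume (x - z) * w z := fun x => by
    rw [mollify_apply, ← integral_sub_left_eq_self _ volume x]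
    simp
  have hi : ∀ x, Integrable fun z => ρ.normed volume (x - z) * w z := fun x => by
    simpa using (integrable_normed_mul_comp_sub ρ hw x).comp_sub_left x
  rw [dist_eq_norm, h, h, ← integral_sub (hi x) (hi y), mul_right_comm, ← integral_const_mul]
  refine norm_integral_le_of_norm_le (hw.norm.const_mul _) (Eventually.of_forall fun z => ?_)
  rw [← sub_mul, norm_mul, ← dist_eq_norm]
  gcongr
  simpa using hL.dist_le_mul (x - z) (y - z)

end

/-! ### Compactness and coercivity -/

variable {n : ℕ} {Ω : Set (EuclideanSpace ℝ (Fin n))}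

/-- For a fixed mollifier, the mollifications of an `L^1`-bounded set of functions form a totally
bounded set in the space of continuous functions on a compact set, by the Arzelà-Ascoli theorem. -/
theorem exists_finite_cover_mollify {ι : Type*} (K : Set (EuclideanSpace ℝ (Fin n))) (hK : IsCompact K)
    (ρ : ContDiffBump (0 : EuclideanSpace ℝ (Fin n))) (a : ℝ≥0)
    (w : ι → EuclideanSpace ℝ (Fin n) → ℝ) (hw : ∀ i, Integrable (w i))
    (ha : ∀ i, eLpNorm (w i) 1 volume ≤ a) {η : ℝ} (hη : 0 < η) :
    ∃ t : Set ι, t.Finite ∧ ∀ i, ∃ j ∈ t, ∀ x ∈ K, dist (mollify ρ (w i) x) (mollify ρ (w j) x) ≤ η := by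
  obtain ⟨C, hC⟩ := ρ.hasCompactSupport_normed.exists_bound_of_continuous
    (ρ.continuous_normed (μ := volume))
  obtain ⟨L, hL⟩ := ContDiff.lipschitzWith_of_hasCompactSupport ρ.hasCompactSupport_normed
    (ρ.contDiff_normed (μ := volume) (n := 1)) one_ne_zero
  have hC0 : 0 ≤ C := (norm_nonneg _).trans (hC 0)
  have ha' : ∀ i, ∫ x, ‖w i x‖ ≤ a := fun i => integral_norm_le_of_eLpNorm_one_le (hw i) (ha i)
  have hlip : ∀ i, LipschitzWith (L * a) (mollify ρ (w i)) := fun i =>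
    LipschitzWith.of_dist_le_mul fun x y =>
      (dist_mollify_le_of_lipschitzWith ρ hL (hw i) x y).trans (by push_cast; gcongr; exact ha' i)
  have : CompactSpace K := isCompact_iff_compactSpace.1 hK
  let f : ι → BoundedContinuousFunction K ℝ := fun i =>
    BoundedContinuousFunction.mkOfCompact ⟨K.domRestrict (mollify ρ (w i)),
      (hlip i).continuous.comp continuous_subtype_val⟩
  have hcomp : IsCompact (closure (range f)) := by
    refine BoundedContinuousFunction.arzela_ascoli (Metric.closedBall 0 (C * a))
      (isCompact_closedBall _ _) _ ?_ ?_
    · rintro _ x ⟨i, rfl⟩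
      rw [mem_closedBall_zero_iff]
      exact (norm_mollify_le_of_bound ρ hC (hw i) x).trans (by gcongr; exact ha' i)
    · refine (LipschitzWith.uniformEquicontinuous _ (L * a) ?_).equicontinuous
      rintro ⟨_, i, rfl⟩
      exact LipschitzWith.of_dist_le_mul fun x y => (hlip i).dist_le_mul x y
  have htb : TotallyBounded (range f) := hcomp.totallyBounded.subset subset_closure
  obtain ⟨s, hs, hsfin, hcov⟩ := Metric.finite_approx_of_totallyBounded htb η hη
  rw [← image_univ] at hs
  obtain ⟨t, -, htfin, hcov⟩ := (exists_subset_image_finite_and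
    (p := fun s => range f ⊆ ⋃ y ∈ s, Metric.ball y η)).1 ⟨s, hs, hsfin, hcov⟩
  refine ⟨t, htfin, fun i => ?_⟩
  obtain ⟨_, ⟨j, hj, rfl⟩, hij⟩ := mem_iUnion₂.1 (hcov ⟨i, rfl⟩)
  exact ⟨j, hj, fun x hx => (BoundedContinuousFunction.dist_coe_le_dist (f := f i) (g := f j)
    ⟨x, hx⟩).trans (Metric.mem_ball.1 hij).le⟩

variable {p : ℝ}

theorem integrable_indicator_Lp [Fact (1 ≤ ENNReal.ofReal p)] (hΩ : IsOpen Ω)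
    (hΩb : Bornology.IsBounded Ω) (v : Lp ℝ (ENNReal.ofReal p) (volume.restrict Ω)) :
    Integrable (Ω.indicator v) := by
  have : IsFiniteMeasure (volume.restrict Ω) := ⟨by
    rw [Measure.restrict_apply_univ]; exact hΩb.measure_lt_top⟩
  exact (integrable_indicator_iff hΩ.measurableSet).2 ((Lp.memLp v).integrable Fact.out)

theorem hasCompactSupport_indicator (hΩb : Bornology.IsBounded Ω)
    (v : EuclideanSpace ℝ (Fin n) → ℝ) : HasCompactSupport (Ω.indicator v) :=
  HasCompactSupport.intro hΩb.isCompact_closure fun _ hx =>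
    indicator_of_notMem (fun h => hx (subset_closure h)) v

theorem eLpNorm_critExponent_restrict_le [Fact (1 ≤ ENNReal.ofReal p)] (hn : 1 ≤ n)
    (hΩ : IsOpen Ω) (hΩb : Bornology.IsBounded Ω) (hΩ' : Ω.Nonempty)
    (v : Lp ℝ (ENNReal.ofReal p) (volume.restrict Ω)) :
    eLpNorm v (critExponent n) (volume.restrict Ω) ≤
      ENNReal.ofReal (embeddingConst Ω) * totalVariation univ (Ω.indicator v) := by
  rw [← eLpNorm_indicator_eq_eLpNorm_restrict hΩ.measurableSet]
  exact eLpNorm_critExponent_le_totalVariation hn hΩ hΩ' (integrable_indicator_Lp hΩ hΩb v)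
    (hasCompactSupport_indicator hΩb v)

/-- On a set of functions with bounded total variation, convergence in `L^1` controls convergence
in `L^p`, uniformly. -/
theorem exists_dist_lt_of_eLpNorm_one_le [Fact (1 ≤ ENNReal.ofReal p)] (hn : 1 ≤ n)
    (hΩ : IsOpen Ω) (hΩb : Bornology.IsBounded Ω) (hΩ' : Ω.Nonempty) (hp : 1 < p)
    (hpn : ENNReal.ofReal p < critExponent n) (b : ℝ≥0) {ε : ℝ} (hε : 0 < ε) :
    ∃ δ : ℝ, 0 < δ ∧ ∀ v v' : Lp ℝ (ENNReal.ofReal p) (volume.restrict Ω),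
      totalVariation univ (Ω.indicator v) ≤ b → totalVariation univ (Ω.indicator v') ≤ b →
      eLpNorm (v - v' : EuclideanSpace ℝ (Fin n) → ℝ) 1 (volume.restrict Ω) ≤ ENNReal.ofReal δ →
      dist v v' < ε := by
  have hp0 : 0 < p := by linarith
  have hθ := interpolation_exponent_pos hn hpn
  set θ : ℝ := (n : ℝ) - ((n : ℝ) - 1) * p
  set B : ℝ≥0∞ := (ENNReal.ofReal (embeddingConst Ω) * b + ENNReal.ofReal (embeddingConst Ω) * b) ^
    ((p - 1) * n) with hB
  have hs : 0 ≤ (p - 1) * n := mul_nonneg (by linarith) (Nat.cast_nonneg _)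
  have hBtop : B ≠ ⊤ := by
    refine ENNReal.rpow_ne_top_of_nonneg hs ?_
    exact ENNReal.add_ne_top.2 ⟨ENNReal.mul_ne_top ENNReal.ofReal_ne_top ENNReal.coe_ne_top,
      ENNReal.mul_ne_top ENNReal.ofReal_ne_top ENNReal.coe_ne_top⟩
  have hlim : Tendsto (fun δ : ℝ => ENNReal.ofReal δ ^ θ * B) (𝓝[>] 0) (𝓝 0) := by
    have h1 : Tendsto (fun δ : ℝ => ENNReal.ofReal δ ^ θ) (𝓝[>] 0) (𝓝 0) := by
      have : Continuous fun δ : ℝ => ENNReal.ofReal δ ^ θ :=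
        ENNReal.continuous_rpow_const.comp ENNReal.continuous_ofReal
      have h := (this.tendsto 0).mono_left (nhdsWithin_le_nhds (s := Ioi 0))
      simpa [ENNReal.zero_rpow_of_pos hθ] using h
    simpa using ENNReal.Tendsto.mul_const h1 (Or.inr hBtop)
  have hεp : (0 : ℝ≥0∞) < ENNReal.ofReal ε ^ p := by
    rw [ENNReal.ofReal_rpow_of_pos hε]
    exact ENNReal.ofReal_pos.2 (Real.rpow_pos_of_pos hε p)
  obtain ⟨δ, hδε, hδ⟩ := ((hlim.eventually_lt_const hεp).and eventually_mem_nhdsWithin).exists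
  refine ⟨δ, hδ, fun v v' hv hv' h1 => ?_⟩
  have hq1 : 1 ≤ critExponent n := (Fact.out : 1 ≤ ENNReal.ofReal p).trans hpn.le
  have hcrit : eLpNorm (v - v' : EuclideanSpace ℝ (Fin n) → ℝ) (critExponent n)
      (volume.restrict Ω) ^ ((p - 1) * n) ≤ B := by
    refine ENNReal.rpow_le_rpow ?_ hs
    refine (eLpNorm_sub_le (Lp.aestronglyMeasurable v) (Lp.aestronglyMeasurable v') hq1).trans ?_
    gcongr
    · exact (eLpNorm_critExponent_restrict_le hn hΩ hΩb hΩ' v).trans (by gcongr)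
    · exact (eLpNorm_critExponent_restrict_le hn hΩ hΩb hΩ' v').trans (by gcongr)
  have hint := eLpNorm_rpow_le_mul_eLpNorm_critExponent hn hp hpn
    ((Lp.aestronglyMeasurable v).sub (Lp.aestronglyMeasurable v'))
  have hlt : eLpNorm (v - v' : EuclideanSpace ℝ (Fin n) → ℝ) (ENNReal.ofReal p)
      (volume.restrict Ω) ^ p < ENNReal.ofReal ε ^ p :=
    hint.trans_lt ((mul_le_mul' (ENNReal.rpow_le_rpow h1 hθ.le) hcrit).trans_lt hδε)
  rw [ENNReal.rpow_lt_rpow_iff hp0] at hlt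
  rw [Lp.dist_def]
  exact ENNReal.toReal_lt_of_lt_ofReal hlt

/-- Compactness of the embedding of `BV` in `L^p` for subcritical `p`: replace the functions by
mollifications, uniformly close in `L^1`, and apply the Arzelà-Ascoli theorem to these. -/
theorem totallyBounded_setOf_totalVariation_le [Fact (1 ≤ ENNReal.ofReal p)] (hn : 1 ≤ n)
    (hΩ : IsOpen Ω) (hΩb : Bornology.IsBounded Ω) (hΩ' : Ω.Nonempty) (hp : 1 < p)
    (hpn : ENNReal.ofReal p < critExponent n) (a b : ℝ≥0) :
    TotallyBounded {v : Lp ℝ (ENNReal.ofReal p) (volume.restrict Ω) |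
      eLpNorm v 1 (volume.restrict Ω) ≤ a ∧ totalVariation univ (Ω.indicator v) ≤ b} := by
  set S := {v : Lp ℝ (ENNReal.ofReal p) (volume.restrict Ω) |
      eLpNorm v 1 (volume.restrict Ω) ≤ a ∧ totalVariation univ (Ω.indicator v) ≤ b} with hS
  refine Metric.totallyBounded_iff.2 fun ε hε => ?_
  obtain ⟨δ, hδ, H⟩ := exists_dist_lt_of_eLpNorm_one_le hn hΩ hΩb hΩ' hp hpn b hε
  set V : ℝ := (volume Ω).toReal with hV
  have hVfin : volume Ω ≠ ⊤ := hΩb.measure_lt_top.ne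
  have hV0 : 0 ≤ V := ENNReal.toReal_nonneg
  -- two mollification errors of size `r * b ≤ δ / 4`, and an error `η * V ≤ δ / 4` in between
  obtain ⟨ρ, hρ, -⟩ := exists_contDiffBump_rOut_eq n (r := δ / (4 * (b + 1))) (by positivity)
  have hη : 0 < δ / (4 * (V + 1)) := by positivity
  obtain ⟨t, ht, hcov⟩ := exists_finite_cover_mollify (closure Ω) hΩb.isCompact_closure ρ a
    (fun v : S => Ω.indicator v.1) (fun v => integrable_indicator_Lp hΩ hΩb v.1)
    (fun v => by rw [eLpNorm_indicator_eq_eLpNorm_restrict hΩ.measurableSet]; exact v.2.1) hη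
  refine ⟨Subtype.val '' t, ht.image _, fun v hv => ?_⟩
  obtain ⟨v', hv't, hd⟩ := hcov ⟨v, hv⟩
  refine mem_iUnion₂.2 ⟨v', mem_image_of_mem _ hv't, H v v' hv.2 v'.2.2 ?_⟩
  have hmoll : ∀ u ∈ S, eLpNorm (fun x => mollify ρ (Ω.indicator u) x - Ω.indicator u x) 1
      (volume.restrict Ω) ≤ ENNReal.ofReal (δ / 4) := by
    intro u hu
    refine (eLpNorm_restrict_le _ _ _ _).trans ((eLpNorm_mollify_sub_le ρ
      (integrable_indicator_Lp hΩ hΩb u) (hasCompactSupport_indicator hΩb u)).trans ?_)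
    refine (mul_le_mul_right hu.2 _).trans ?_
    rw [hρ, ← ENNReal.ofReal_coe_nnreal, ← ENNReal.ofReal_mul (by positivity)]
    refine ENNReal.ofReal_le_ofReal ?_
    rw [div_mul_eq_mul_div, div_le_div_iff₀ (by positivity) (by norm_num)]
    nlinarith [b.coe_nonneg]
  have hmid : eLpNorm (fun x => mollify ρ (Ω.indicator v) x - mollify ρ (Ω.indicator v'.1) x) 1
      (volume.restrict Ω) ≤ ENNReal.ofReal (δ / 4) := by
    rw [eLpNorm_one_eq_lintegral_enorm]
    calc ∫⁻ x in Ω, ‖mollify ρ (Ω.indicator v) x - mollify ρ (Ω.indicator v'.1) x‖ₑ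
        ≤ ∫⁻ _ in Ω, ENNReal.ofReal (δ / (4 * (V + 1))) := by
          refine setLIntegral_mono measurable_const fun x hx => ?_
          rw [← ofReal_norm, ← dist_eq_norm]
          exact ENNReal.ofReal_le_ofReal (hd x (subset_closure hx))
      _ = ENNReal.ofReal (δ / (4 * (V + 1)) * V) := by
          rw [setLIntegral_const, ENNReal.ofReal_mul hη.le, hV, ENNReal.ofReal_toReal hVfin]
      _ ≤ ENNReal.ofReal (δ / 4) := by
          refine ENNReal.ofReal_le_ofReal ?_
          rw [div_mul_eq_mul_div, div_le_div_iff₀ (by positivity) (by norm_num)]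
          nlinarith
  have hmeas : ∀ u : Lp ℝ (ENNReal.ofReal p) (volume.restrict Ω),
      Continuous (mollify ρ (Ω.indicator u)) := fun u =>
    (isTestFunction_mollify ρ (integrable_indicator_Lp hΩ hΩb u)
      (hasCompactSupport_indicator hΩb u)).1.continuous
  have hmeas' : ∀ u : Lp ℝ (ENNReal.ofReal p) (volume.restrict Ω),
      AEStronglyMeasurable (Ω.indicator u) (volume.restrict Ω) := fun u =>
    (integrable_indicator_Lp hΩ hΩb u).1.restrict
  have hdecomp : eLpNorm (v - v'.1 : EuclideanSpace ℝ (Fin n) → ℝ) 1 (volume.restrict Ω) =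
      eLpNorm (((fun x => mollify ρ (Ω.indicator v) x - mollify ρ (Ω.indicator v'.1) x) -
        (fun x => mollify ρ (Ω.indicator v) x - Ω.indicator v x)) +
        (fun x => mollify ρ (Ω.indicator v'.1) x - Ω.indicator v'.1 x)) 1 (volume.restrict Ω) := by
    refine eLpNorm_congr_ae ?_
    filter_upwards [ae_restrict_mem hΩ.measurableSet] with x hx
    simp [indicator_of_mem hx]
  have m1 := ((hmeas v).sub (hmeas v'.1)).aestronglyMeasurable (μ := volume.restrict Ω)
  have m2 := ((hmeas v).aestronglyMeasurable (μ := volume.restrict Ω)).sub (hmeas' v)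
  have m3 := ((hmeas v'.1).aestronglyMeasurable (μ := volume.restrict Ω)).sub (hmeas' v'.1)
  rw [hdecomp]
  refine (eLpNorm_add_le (m1.sub m2) m3 le_rfl).trans
    ((add_le_add (eLpNorm_sub_le m1 m2 le_rfl) le_rfl).trans
    ((add_le_add (add_le_add hmid (hmoll v hv)) (hmoll v' v'.2)).trans ?_))
  rw [← ENNReal.ofReal_add (by positivity) (by positivity),
    ← ENNReal.ofReal_add (by positivity) (by positivity)]
  exact ENNReal.ofReal_le_ofReal (by linarith)

/-- A real number with `x - κ x ^ s ≤ M` is bounded when the growth is sublinear, `s ≤ 1`, and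
`κ < 1`. -/
theorem le_div_of_sub_mul_rpow_le {x κ s M : ℝ} (hx : 0 ≤ x) (hκ0 : 0 ≤ κ) (hκ : κ < 1)
    (hs0 : 0 ≤ s) (hs : s ≤ 1) (h : x - κ * x ^ s ≤ M) : x ≤ (M + κ) / (1 - κ) := by
  have hxs : x ^ s ≤ 1 + x := by
    rcases le_total x 1 with h1 | h1
    · exact (Real.rpow_le_one hx h1 hs0).trans (by linarith)
    · calc x ^ s ≤ x ^ (1 : ℝ) := Real.rpow_le_rpow_of_exponent_le h1 hs
        _ ≤ 1 + x := by rw [Real.rpow_one]; linarith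
  rw [le_div_iff₀ (by linarith)]
  nlinarith [mul_le_mul_of_nonneg_left hxs hκ0]

theorem eLpNorm_one_eq_ofReal_massG {v : EuclideanSpace ℝ (Fin n) → ℝ} (hv : IntegrableOn v Ω) :
    eLpNorm v 1 (volume.restrict Ω) = ENNReal.ofReal (massG Ω v) := by
  rw [eLpNorm_one_eq_lintegral_enorm, ← ofReal_integral_norm_eq_lintegral_enorm hv]
  rfl

/-- A bound on the energy means that the mass constraint holds and that the total variation is
finite. -/
theorem massG_eq_of_totalEnergy_lt {EPer : Lp ℝ (ENNReal.ofReal p) (volume.restrict Ω) → ℝ}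
    {α c : ℝ} {v : Lp ℝ (ENNReal.ofReal p) (volume.restrict Ω)}
    (h : totalEnergy Ω EPer α v < (c : EReal)) :
    massG Ω v = α ∧ totalVariation univ (Ω.indicator v) ≠ ⊤ ∧
      (totalVariation univ (Ω.indicator v)).toReal + EPer v ≤ c := by
  have hE : ((energyTV Ω v : ℝ≥0∞) : EReal) + ((EPer v : ℝ) : EReal) ≠ ⊥ := by
    rw [Ne, EReal.add_eq_bot_iff]
    simp
  have hmass : massG Ω v = α := by
    by_contra hne
    have hind : indicatorFun {w : Lp ℝ (ENNReal.ofReal p) (volume.restrict Ω) | massG Ω w = α} v =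
        ⊤ := if_neg hne
    rw [totalEnergy, hind, EReal.add_top_of_ne_bot hE] at h
    exact not_top_lt h
  have hind : indicatorFun {w : Lp ℝ (ENNReal.ofReal p) (volume.restrict Ω) | massG Ω w = α} v =
      0 := if_pos hmass
  rw [totalEnergy, hind, add_zero] at h
  have hfin : energyTV Ω v ≠ ⊤ := by
    intro htop
    rw [htop, EReal.coe_ennreal_top, EReal.top_add_coe] at h
    exact not_top_lt h
  have hBV : MemBV Ω v := by
    by_contra hne
    exact hfin (if_neg hne)
  rw [show energyTV Ω v = totalVariation univ (Ω.indicator v) from if_pos hBV] at h hfin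
  rw [← EReal.coe_ennreal_toReal hfin] at h
  exact ⟨hmass, hfin, by exact_mod_cast h.le⟩

/-- The Sobolev and interpolation inequalities combined. -/
theorem norm_rpow_le_massG_mul_totalVariation [Fact (1 ≤ ENNReal.ofReal p)] (hn : 1 ≤ n)
    (hΩ : IsOpen Ω) (hΩb : Bornology.IsBounded Ω) (hΩ' : Ω.Nonempty) (hp : 1 < p)
    (hpn : ENNReal.ofReal p < critExponent n) {v : Lp ℝ (ENNReal.ofReal p) (volume.restrict Ω)}
    (hv : totalVariation univ (Ω.indicator v) ≠ ⊤) :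
    ‖v‖ ^ p ≤ massG Ω v ^ ((n : ℝ) - ((n : ℝ) - 1) * p) *
      (embeddingConst Ω * (totalVariation univ (Ω.indicator v)).toReal) ^ ((p - 1) * n) := by
  have hθ := interpolation_exponent_pos hn hpn
  have hs : 0 ≤ (p - 1) * n := mul_nonneg (by linarith) (Nat.cast_nonneg _)
  have hm : 0 ≤ massG Ω v := integral_nonneg fun x => abs_nonneg _
  have hC := embeddingConst_nonneg Ω
  have h := (eLpNorm_rpow_le_mul_eLpNorm_critExponent hn hp hpn
    (Lp.aestronglyMeasurable v)).trans (mul_le_mul_right (ENNReal.rpow_le_rpow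
      (eLpNorm_critExponent_restrict_le hn hΩ hΩb hΩ' v) hs) _)
  rw [eLpNorm_one_eq_ofReal_massG ((integrable_indicator_iff hΩ.measurableSet).1
    (integrable_indicator_Lp hΩ hΩb v)), ← ENNReal.ofReal_toReal hv,
    ← ENNReal.ofReal_mul hC, ENNReal.ofReal_rpow_of_nonneg hm hθ.le,
    ENNReal.ofReal_rpow_of_nonneg (mul_nonneg hC ENNReal.toReal_nonneg) hs,
    ← ENNReal.ofReal_mul (Real.rpow_nonneg hm _)] at h
  have h' := ENNReal.toReal_mono ENNReal.ofReal_ne_top h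
  rw [← ENNReal.toReal_rpow, ENNReal.toReal_ofReal (mul_nonneg (Real.rpow_nonneg hm _)
    (Real.rpow_nonneg (mul_nonneg hC ENNReal.toReal_nonneg) _))] at h'
  rwa [Lp.norm_def]

/-- Coercivity: a bound on the energy bounds the total variation. If `EPer` is not bounded below,
the interpolation inequality bounds `|EPer|` by `κ TV ^ s` with `s ≤ 1` and `κ < 1`. -/
theorem exists_totalVariation_le_of_totalEnergy_lt [Fact (1 ≤ ENNReal.ofReal p)] (hn : 1 ≤ n)
    (hΩ : IsOpen Ω) (hΩb : Bornology.IsBounded Ω) (hΩ' : Ω.Nonempty) (hp : 1 < p)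
    (hpn : ENNReal.ofReal p < critExponent n) {α : ℝ} (hα : 0 < α)
    {EPer : Lp ℝ (ENNReal.ofReal p) (volume.restrict Ω) → ℝ} {CPer : ℝ} (hCPer : 0 < CPer)
    (hE3 : ∀ v, |EPer v| ≤ CPer * ‖v‖ ^ p)
    (hE5 : (∃ L : ℝ, ∀ v, L ≤ EPer v) ∨
      (p ≤ 1 + 1 / (n : ℝ) ∧
        α ^ ((n : ℝ) - ((n : ℝ) - 1) * p) <
          CPer⁻¹ * embeddingConst Ω ^ (-((p - 1) * (n : ℝ))))) (c : ℝ) :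
    ∃ b : ℝ≥0, ∀ v, totalEnergy Ω EPer α v < (c : EReal) →
      totalVariation univ (Ω.indicator v) ≤ b := by
  suffices H : ∃ b : ℝ, ∀ v, totalEnergy Ω EPer α v < (c : EReal) →
      (totalVariation univ (Ω.indicator v)).toReal ≤ b by
    obtain ⟨b, hb⟩ := H
    refine ⟨b.toNNReal, fun v hv => ?_⟩
    rw [← ENNReal.ofReal_toReal (massG_eq_of_totalEnergy_lt hv).2.1]
    exact ENNReal.ofReal_le_ofReal (hb v hv)
  rcases hE5 with ⟨L, hL⟩ | ⟨hpn', hαlt⟩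
  · refine ⟨c - L, fun v hv => ?_⟩
    linarith [(massG_eq_of_totalEnergy_lt hv).2.2, hL v]
  · set s := (p - 1) * (n : ℝ) with hs_def
    set θ := (n : ℝ) - ((n : ℝ) - 1) * p with hθ_def
    set C := embeddingConst Ω with hC_def
    have hn0 : (0 : ℝ) < n := by exact_mod_cast hn
    have hs : 0 < s := mul_pos (by linarith) hn0
    have hs1 : s ≤ 1 := by
      calc s ≤ 1 / (n : ℝ) * n := by rw [hs_def]; gcongr; linarith
        _ = 1 := by field_simp
    have hC0 : 0 ≤ C := embeddingConst_nonneg Ω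
    have hCs : 0 ≤ C ^ s := Real.rpow_nonneg hC0 s
    have hκ0 : 0 ≤ CPer * α ^ θ * C ^ s := by positivity
    have hκ : CPer * α ^ θ * C ^ s < 1 := by
      rcases hCs.eq_or_lt with h0 | hpos
      · simp [← h0]
      · rw [Real.rpow_neg hC0, ← mul_inv] at hαlt
        calc CPer * α ^ θ * C ^ s = α ^ θ * (CPer * C ^ s) := by ring
          _ < (CPer * C ^ s)⁻¹ * (CPer * C ^ s) := by gcongr
          _ = 1 := inv_mul_cancel₀ (by positivity)
    refine ⟨(c + CPer * α ^ θ * C ^ s) / (1 - CPer * α ^ θ * C ^ s), fun v hv => ?_⟩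
    obtain ⟨hmass, hfin, hle⟩ := massG_eq_of_totalEnergy_lt hv
    refine le_div_of_sub_mul_rpow_le ENNReal.toReal_nonneg hκ0 hκ hs.le hs1 ?_
    have h1 := norm_rpow_le_massG_mul_totalVariation hn hΩ hΩb hΩ' hp hpn hfin
    rw [hmass, Real.mul_rpow hC0 ENNReal.toReal_nonneg] at h1
    have h2 := (abs_le.1 (hE3 v)).1
    have h3 := mul_le_mul_of_nonneg_left h1 hCPer.le
    linarith

theorem proposition3p1 (n : ℕ) (hn : 1 ≤ n) (Ω : Set (EuclideanSpace ℝ (Fin n)))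
    (hΩ_open : IsOpen Ω) (hΩ_bdd : Bornology.IsBounded Ω) (hΩ_lip : HasLipschitzBoundary Ω)
    (p : ℝ) [Fact (1 ≤ ENNReal.ofReal p)] (hp : 1 < p)
    (hpn : ENNReal.ofReal p < critExponent n)
    (α : ℝ) (hα : 0 < α)
    (EPer : Lp ℝ (ENNReal.ofReal p) (volume.restrict Ω) → ℝ)
    (hE1 : LocallyLipschitz EPer)
    (hE2 : ∀ v, EPer v = EPer (-v))
    (CPer : ℝ) (hCPer : 0 < CPer)
    (hE3 : ∀ v, |EPer v| ≤ CPer * ‖v‖ ^ p)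
    (hE4 : ∀ v, ∀ ξ ∈ clarkeGradient EPer v, ‖ξ‖ ≤ p * CPer * ‖v‖ ^ (p - 1))
    (hE5 : (∃ L : ℝ, ∀ v, L ≤ EPer v) ∨
      (p ≤ 1 + 1 / (n : ℝ) ∧
        α ^ ((n : ℝ) - ((n : ℝ) - 1) * p) <
          CPer⁻¹ * embeddingConst Ω ^ (-((p - 1) * (n : ℝ))))) :
    PalaisSmale (totalEnergy Ω EPer α) := by
  intro c u hu _
  have hev : ∀ᶠ j in atTop, totalEnergy Ω EPer α (u j) < ((c + 1 : ℝ) : EReal) :=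
    hu.eventually_lt_const (by exact_mod_cast lt_add_one c)
  have hne : Ω.Nonempty := by
    -- on the empty set the mass constraint `0 = α` cannot be met
    rw [nonempty_iff_ne_empty]
    rintro rfl
    obtain ⟨j, hj⟩ := hev.exists
    have h := (massG_eq_of_totalEnergy_lt hj).1
    simp only [massG, Measure.restrict_empty, integral_zero_measure] at h
    exact hα.ne h
  obtain ⟨b, hb⟩ := exists_totalVariation_le_of_totalEnergy_lt hn hΩ_open hΩ_bdd hne hp hpn hα
    hCPer hE3 hE5 (c + 1)
  have htb := totallyBounded_setOf_totalVariation_le (p := p) hn hΩ_open hΩ_bdd hne hp hpn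
    α.toNNReal b
  obtain ⟨x, -, k, hk, hx⟩ := (htb.closure.isCompact_of_isClosed
    isClosed_closure).tendsto_subseq' (x := u) (Eventually.frequently (by
      filter_upwards [hev] with j hj
      refine subset_closure ⟨?_, hb _ hj⟩
      rw [eLpNorm_one_eq_ofReal_massG ((integrable_indicator_iff hΩ_open.measurableSet).1
        (integrable_indicator_Lp hΩ_open hΩ_bdd (u j))), (massG_eq_of_totalEnergy_lt hj).1]
      rfl))
  exact ⟨k, hk, x, hx⟩
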